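/- Let $n\ge 1$ and consider scalar-valued (real or complex) functions on $\mathbb R^n$, identified when they agree almost everywhere; vector spaces are over the same scalars. Write $\ln_+ s=\max(\ln s,0)$ for $s>0$ and $\ln_+0=0$. Let $\mathcal H^1(\mathbb R^n)$ be the Hardy space of all $f\in L^1(\mathbb R^n)$ such that, for some smooth function $\varphi$ supported in the unit ball with $\int\varphi\,dx\neq 0$, the maximal function $$\mathcal M_\varphi f(x)=\sup_{t>0}|\varphi_t*f(x)|,\qquad \varphi_t(x)=t^{-n}\varphi(t^{-1}x),$$ is integrable on $\mathbb R^n$. Then the set of all $f\in L^1(\mathbb R^n)$ satisfying $$\int_{\mathbb R^n}|f(x)|\left(\ln_+|f(x)|+\ln_+|x|\right)dx<\infty$$ is a vector space, and it is the largest vector space $S\subseteq L^1(\mathbb R^n)$ with the following property: whenever $g\in S$ and $f$ is an integrable function such that $|f|\le|g|$ almost everywhere and $\int_{\mathbb R^n}f\,dx=0$, then $f\in\mathcal H^1(\mathbb R^n)$. That is, this vector space has the property, and it contains every vector space $S\subseteq L^1(\mathbb R^n)$ that has the property. -/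

import Mathlib

open MeasureTheory
open scoped ENNReal

noncomputable section

/-- `φ` is a smooth function supported in the unit ball of `ℝⁿ`, with nonzero integral. -/
def IsMaximalKernel {𝕜 : Type*} [RCLike 𝕜] {n : ℕ} (φ : EuclideanSpace ℝ (Fin n) → 𝕜) : Prop :=
  ContDiff ℝ (⊤ : ℕ∞) φ ∧ Function.support φ ⊆ Metric.ball 0 1 ∧ ∫ x, φ x ≠ 0

/-- The dilation `φ_t(x) = t⁻ⁿ φ(t⁻¹ x)`. -/
def dilate {𝕜 : Type*} [RCLike 𝕜] {n : ℕ} (φ : EuclideanSpace ℝ (Fin n) → 𝕜) (t : ℝ) :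
    EuclideanSpace ℝ (Fin n) → 𝕜 :=
  fun x => (t ^ n)⁻¹ • φ (t⁻¹ • x)

/-- The maximal function `M_φ f(x) = sup_{t > 0} |φ_t * f(x)|`, with values in `[0, ∞]`. -/
def maximalFunction {𝕜 : Type*} [RCLike 𝕜] {n : ℕ} (φ f : EuclideanSpace ℝ (Fin n) → 𝕜)
    (x : EuclideanSpace ℝ (Fin n)) : ℝ≥0∞ :=
  ⨆ (t : ℝ) (_ : 0 < t), ‖convolution (dilate φ t) f (ContinuousLinearMap.mul 𝕜 𝕜) volume x‖ₑ

/-- The Hardy space `H¹(ℝⁿ)`: the integrable functions `f` such that `M_φ f` is integrable for some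
smooth `φ` supported in the unit ball with nonzero integral. -/
def hardySpace (𝕜 : Type*) [RCLike 𝕜] (n : ℕ) :
    Set (Lp 𝕜 1 (volume : Measure (EuclideanSpace ℝ (Fin n)))) :=
  {f | ∃ φ : EuclideanSpace ℝ (Fin n) → 𝕜, IsMaximalKernel φ ∧ ∫⁻ x, maximalFunction φ f x < ∞}

/-- The integrable functions `f` with `∫ |f| (ln₊ |f| + ln₊ |x|) dx < ∞`. -/
def logIntegrable (𝕜 : Type*) [RCLike 𝕜] (n : ℕ) :
    Set (Lp 𝕜 1 (volume : Measure (EuclideanSpace ℝ (Fin n)))) :=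
  {f | ∫⁻ x, ‖f x‖ₑ * ENNReal.ofReal (Real.posLog ‖f x‖ + Real.posLog ‖x‖) < ∞}

/-- Whenever `g ∈ S` and `f` is integrable with `|f| ≤ |g|` a.e. and `∫ f = 0`, then
`f ∈ H¹(ℝⁿ)`. -/
def DominationProperty {𝕜 : Type*} [RCLike 𝕜] {n : ℕ}
    (S : Submodule 𝕜 (Lp 𝕜 1 (volume : Measure (EuclideanSpace ℝ (Fin n))))) : Prop :=
  ∀ g ∈ S, ∀ f : Lp 𝕜 1 (volume : Measure (EuclideanSpace ℝ (Fin n))),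
    (∀ᵐ x, ‖f x‖ ≤ ‖g x‖) → ∫ x, f x = 0 → f ∈ hardySpace 𝕜 n

end

/-!
For a function `f` of mean value zero, `M_φ f` is compared with the Hardy–Littlewood maximal
function in one direction and, when `f` is essentially nonnegative, bounded below in the other.

*The logarithmic moment suffices.* Let `φ` be a bump function. On the unit ball `M_φ f` is dominated
by the Hardy–Littlewood maximal function of `f`, which is locally integrable when `f ∈ L log L`
(`exists_setLIntegral_maxAverage_le`). On a dyadic annulus `‖x‖ ∼ 2 ^ j` the mean value zero allows
`φ_t(x - y)` to be replaced by `φ_t(x - y) - φ_t(x)`. The part `‖y‖ ≪ 2 ^ j` then gains a factor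
`‖y‖ / 2 ^ j`, the part `‖y‖ ≫ 2 ^ j` is bounded by the mass of `f` there, and only the part
`‖y‖ ∼ 2 ^ j` needs the maximal function, to which the `L log L` bound is applied at the level
`2 ^ (-j (n + 1))`. Summing over `j` produces the factor `ln₊ ‖y‖`
(`IsMaximalKernel.lintegral_maximalFunction_lt_top`).

*It is necessary.* If a space with the domination property contains `g`, it contains its multiples,
and the property applies to `f = |g| - k`, where `k` is bounded with bounded support and balances
the integral. So `M_φ f` is integrable for some kernel `φ`, over whose choice there is no control:
it may oscillate, or be complex-valued. Two facts replace the independence of the Hardy space from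
the kernel.

* Let `B` be a ball on which the average of `|g|` is about `l`, while its averages over larger
  concentric balls do not exceed `l`. A Lipschitz cutoff adapted to `B`, convolved with a kernel of
  much smaller scale, is `∫ φ` times the cutoff up to a small error, so testing against the cutoff
  shows that `M_φ |g|` is at least of order `l` on a fixed proportion of `2 B`
  (`IsMaximalKernel.exists_le_volume_lt_maximalFunction`). With the Vitali covering lemma this gives
  a reverse weak-type inequality (`IsMaximalKernel.exists_setLIntegral_le_volume`), and integration
  over `l` gives `g ∈ L log L`.
* For small `ε`, the integral `c` of `φ` over `ε ≤ ‖x‖ < 1` is nonzero. Integrating `φ_r * f` over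
  `ε r ≤ ‖x‖ < r` gives, up to a summable error, `c` times the integral of `f` over the ball of
  radius `r`, that is, `-c` times its integral outside. For radii in a progression of ratio `1 / ε`
  these annuli are disjoint, so the masses of `g` outside the corresponding balls are summable,
  which means that `|g| ln₊ |x|` is integrable
  (`IsMaximalKernel.lintegral_mul_posLog_norm_lt_top`).

Logarithms are produced throughout by counting the terms of a geometric progression below a given
number, which turns integrals over levels or radii into sums.
-/

noncomputable section

/-! ### Counting the terms of a geometric progression -/

/-- The indices `i` with `b * a ^ i < s` form the initial segment of `ℕ` of length
`⌈log (s / b) / log a⌉₊`. -/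
theorem mul_pow_lt_iff_lt_ceil {a b s : ℝ} (ha : 1 < a) (hb : 0 < b) (hs : 0 < s) (i : ℕ) :
    b * a ^ i < s ↔ i < ⌈Real.log (s / b) / Real.log a⌉₊ := by
  have hla := Real.log_pos ha
  rw [Nat.lt_ceil, lt_div_iff₀ hla, ← Real.log_pow,
    Real.log_lt_log_iff (by positivity) (by positivity), lt_div_iff₀ hb, mul_comm]

theorem tsum_ite_mul_pow_lt {a b s : ℝ} (ha : 1 < a) (hb : 0 < b) (hs : 0 < s) :
    ∑' i : ℕ, (if b * a ^ i < s then (1 : ℝ≥0∞) else 0)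
      = (⌈Real.log (s / b) / Real.log a⌉₊ : ℝ≥0∞) := by
  simp_rw [mul_pow_lt_iff_lt_ceil ha hb hs]
  rw [tsum_eq_sum (s := Finset.range ⌈Real.log (s / b) / Real.log a⌉₊)]
  · rw [Finset.sum_congr rfl (g := fun _ => (1 : ℝ≥0∞))
      (fun i hi => if_pos (Finset.mem_range.1 hi))]
    simp
  · intro i hi
    exact if_neg (fun h => hi (Finset.mem_range.2 h))

theorem tsum_ite_mul_pow_lt_le {a b s : ℝ} (ha : 1 < a) (hb : 0 < b) (hs : 0 ≤ s) :
    ∑' i : ℕ, (if b * a ^ i < s then (1 : ℝ≥0∞) else 0)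
      ≤ 1 + ENNReal.ofReal (Real.posLog (s / b) / Real.log a) := by
  rcases hs.eq_or_lt with rfl | hs
  · have : ∀ i : ℕ, ¬ b * a ^ i < 0 := fun i => not_lt.2 (by positivity)
    simp [this]
  have hla := Real.log_pos ha
  rw [tsum_ite_mul_pow_lt ha hb hs, ← ENNReal.ofReal_natCast, ← ENNReal.ofReal_one,
    ← ENNReal.ofReal_add zero_le_one (div_nonneg Real.posLog_nonneg hla.le)]
  refine ENNReal.ofReal_le_ofReal ?_
  rcases le_total 0 (Real.log (s / b)) with h | h
  · have h1 := (Nat.ceil_lt_add_one (div_nonneg h hla.le)).le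
    have h2 : Real.log (s / b) ≤ Real.posLog (s / b) := le_max_right _ _
    have h3 := div_le_div_of_nonneg_right h2 hla.le
    linarith
  · rw [Nat.ceil_eq_zero.2 (div_nonpos_of_nonpos_of_nonneg h hla.le)]
    have := div_nonneg (Real.posLog_nonneg (x := s / b)) hla.le
    simp only [Nat.cast_zero]
    linarith

theorem ofReal_posLog_le_tsum {a b s : ℝ} (ha : 1 < a) (hb : 0 < b) (hs : 0 ≤ s) :
    ENNReal.ofReal (Real.posLog (s / b))
      ≤ ENNReal.ofReal (Real.log a) * ∑' i : ℕ, (if b * a ^ i < s then (1 : ℝ≥0∞) else 0) := by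
  rcases hs.eq_or_lt with rfl | hs
  · simp
  have hla := Real.log_pos ha
  rw [tsum_ite_mul_pow_lt ha hb hs, ← ENNReal.ofReal_natCast, ← ENNReal.ofReal_mul hla.le]
  refine ENNReal.ofReal_le_ofReal (max_le (by positivity) ?_)
  have := Nat.le_ceil (Real.log (s / b) / Real.log a)
  rwa [div_le_iff₀ hla, mul_comm] at this

/-- At most `m` terms of a geometric progression of ratio `a` lie in a window `(z / q, z / p]`
with `q ≤ p * a ^ m`. -/
theorem tsum_ite_window_le {a p q z : ℝ} {m : ℕ} (ha : 1 < a) (hp : 0 < p) (hq : q ≤ p * a ^ m) :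
    ∑' i : ℕ, (if p * a ^ i ≤ z ∧ z < q * a ^ i then (1 : ℝ≥0∞) else 0) ≤ m := by
  classical
  by_cases h : ∃ i : ℕ, p * a ^ i ≤ z ∧ z < q * a ^ i
  · have hfind := Nat.find_spec h
    set i₀ := Nat.find h
    have hsub : ∀ i : ℕ, (p * a ^ i ≤ z ∧ z < q * a ^ i) → i ∈ Finset.Ico i₀ (i₀ + m) := by
      intro i hi
      refine Finset.mem_Ico.2 ⟨Nat.find_min' h hi, ?_⟩
      by_contra! hle
      have h1 : p * a ^ (i₀ + m) ≤ p * a ^ i :=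
        mul_le_mul_of_nonneg_left (pow_le_pow_right₀ ha.le hle) hp.le
      have h2 : q * a ^ i₀ ≤ p * a ^ m * a ^ i₀ :=
        mul_le_mul_of_nonneg_right hq (by positivity)
      have h3 : p * a ^ m * a ^ i₀ = p * a ^ (i₀ + m) := by ring
      linarith [hi.1, hfind.2]
    rw [tsum_eq_sum (s := Finset.Ico i₀ (i₀ + m)) (fun i hi => if_neg (fun h => hi (hsub i h)))]
    refine (Finset.sum_le_sum (g := fun _ => (1 : ℝ≥0∞)) (fun i _ => ?_)).trans ?_
    · split_ifs <;> simp
    · simp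
  · push Not at h
    have : ∀ i : ℕ, ¬ (p * a ^ i ≤ z ∧ z < q * a ^ i) := fun i hi => not_lt.2 (h i hi.1) hi.2
    simp [this]

/-- The sum of `z / (b * a ^ i)` over the indices where this ratio is at most one is bounded
independently of `z`. -/
theorem tsum_ite_div_mul_pow_le {a b z : ℝ} (ha : 1 < a) (hb : 0 < b) :
    ∑' i : ℕ, (if z ≤ b * a ^ i then ENNReal.ofReal (z / (b * a ^ i)) else 0)
      ≤ (1 - ENNReal.ofReal a⁻¹)⁻¹ := by
  classical
  have ha0 : 0 < a := by linarith
  by_cases h : ∃ i : ℕ, z ≤ b * a ^ i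
  · have hfind := Nat.find_spec h
    have hmin : ∀ i, i < Nat.find h → ¬ z ≤ b * a ^ i := fun i hi => Nat.find_min h hi
    set i₀ := Nat.find h
    rw [← ENNReal.summable.sum_add_tsum_nat_add' (k := i₀),
      Finset.sum_eq_zero (fun i hi => if_neg (hmin i (Finset.mem_range.1 hi))), zero_add,
      ← ENNReal.tsum_geometric]
    refine ENNReal.tsum_le_tsum fun i => ?_
    split_ifs
    · rw [← ENNReal.ofReal_pow (by positivity)]
      refine ENNReal.ofReal_le_ofReal ?_
      rw [div_le_iff₀ (by positivity), inv_pow, pow_add]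
      have : (a ^ i)⁻¹ * (b * (a ^ i * a ^ i₀)) = b * a ^ i₀ := by field_simp
      rwa [this]
    · exact zero_le
  · push Not at h
    simp [fun i => not_le.2 (h i)]

theorem ENNReal.sum_range_ofReal_mul_two_pow {b : ℝ} (hb : 0 < b) (m : ℕ) :
    ∑ i ∈ Finset.range m, ENNReal.ofReal (b * 2 ^ i) = ENNReal.ofReal (b * (2 ^ m - 1)) := by
  rw [← ENNReal.ofReal_sum_of_nonneg (fun i _ => by positivity), ← Finset.mul_sum,
    geom_sum_eq (by norm_num)]
  norm_num

theorem ENNReal.exists_le_ofReal_mul_two_pow {b : ℝ} (hb : 0 < b) {u : ℝ≥0∞} (hu : u ≠ ∞) :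
    ∃ m : ℕ, u ≤ ENNReal.ofReal (b * 2 ^ m) := by
  obtain ⟨m, hm⟩ := pow_unbounded_of_one_lt (u.toReal / b) (_root_.one_lt_two : (1 : ℝ) < 2)
  refine ⟨m, (ENNReal.le_ofReal_iff_toReal_le hu (by positivity)).2 ?_⟩
  rw [div_lt_iff₀ hb] at hm
  linarith

/-- A dyadic substitute for the layer-cake formula, upper half: summing the levels `b * 2 ^ i`
that lie below `u` recovers `u` up to an error `b`. -/
theorem ENNReal.le_add_tsum_levels {b : ℝ} (hb : 0 < b) (u : ℝ≥0∞) :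
    u ≤ ENNReal.ofReal b + ∑' i : ℕ, (if ENNReal.ofReal (b * 2 ^ i) < u
      then ENNReal.ofReal (b * 2 ^ i) else 0) := by
  classical
  rcases eq_or_ne u ∞ with rfl | hu
  · have h1 : ∑' _ : ℕ, ENNReal.ofReal b = ∞ :=
      ENNReal.tsum_const_eq_top_of_ne_zero (by simpa using hb)
    rw [← h1]
    refine (ENNReal.tsum_le_tsum fun i => ?_).trans le_add_self
    rw [h1, if_pos ENNReal.ofReal_lt_top]
    exact ENNReal.ofReal_le_ofReal
      (le_mul_of_one_le_right hb.le (one_le_pow₀ one_le_two))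
  · have h := ENNReal.exists_le_ofReal_mul_two_pow hb hu
    have hfind := Nat.find_spec h
    have hmin : ∀ i, i < Nat.find h → ENNReal.ofReal (b * 2 ^ i) < u :=
      fun i hi => not_le.1 (Nat.find_min h hi)
    set m := Nat.find h
    calc u ≤ ENNReal.ofReal (b * 2 ^ m) := hfind
      _ = ENNReal.ofReal b + ENNReal.ofReal (b * (2 ^ m - 1)) := by
        rw [← ENNReal.ofReal_add hb.le
          (mul_nonneg hb.le (sub_nonneg.2 (one_le_pow₀ one_le_two)))]
        congr 1; ring
      _ = ENNReal.ofReal b + ∑ i ∈ Finset.range m, (if ENNReal.ofReal (b * 2 ^ i) < u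
            then ENNReal.ofReal (b * 2 ^ i) else 0) := by
        rw [← ENNReal.sum_range_ofReal_mul_two_pow hb]
        congr 1
        exact Finset.sum_congr rfl fun i hi => (if_pos (hmin i (Finset.mem_range.1 hi))).symm
      _ ≤ _ := by
        gcongr
        exact ENNReal.sum_le_tsum _

/-- A dyadic substitute for the layer-cake formula, lower half. -/
theorem ENNReal.tsum_levels_le {b : ℝ} (hb : 0 < b) (u : ℝ≥0∞) :
    ∑' i : ℕ, (if ENNReal.ofReal (b * 2 ^ i) < u then ENNReal.ofReal (b * 2 ^ i) else 0)
      ≤ 2 * u := by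
  classical
  rcases eq_or_ne u ∞ with rfl | hu
  · simp
  have h := ENNReal.exists_le_ofReal_mul_two_pow hb hu
  have hfind := Nat.find_spec h
  have hmin : ∀ i, i < Nat.find h → ENNReal.ofReal (b * 2 ^ i) < u :=
    fun i hi => not_le.1 (Nat.find_min h hi)
  set m := Nat.find h
  rw [tsum_eq_sum (s := Finset.range m)]
  · refine (Finset.sum_le_sum (g := fun i => ENNReal.ofReal (b * 2 ^ i)) fun i _ => ?_).trans ?_
    · split_ifs <;> simp
    · rw [ENNReal.sum_range_ofReal_mul_two_pow hb]
      rcases Nat.eq_zero_or_pos m with hm | hm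
      · simp [hm]
      · refine le_trans ?_ (mul_le_mul_right (hmin (m - 1) (by omega)).le 2)
        rw [← ENNReal.ofReal_ofNat 2, ← ENNReal.ofReal_mul zero_le_two]
        refine ENNReal.ofReal_le_ofReal ?_
        have : (2 : ℝ) ^ m = 2 ^ (m - 1) * 2 := by rw [← pow_succ]; congr 1; omega
        rw [this]
        nlinarith
  · intro i hi
    refine if_neg (not_lt.2 (hfind.trans (ENNReal.ofReal_le_ofReal ?_)))
    have : m ≤ i := by simpa using hi
    gcongr
    norm_num

/-! ### Covering by balls and the weak-type estimate -/

section Covering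

variable {n : ℕ}

theorem volume_closedBall_eq (x : EuclideanSpace ℝ (Fin n)) {r : ℝ} (hr : 0 ≤ r) :
    volume (Metric.closedBall x r)
      = ENNReal.ofReal (r ^ n) * volume (Metric.ball (0 : EuclideanSpace ℝ (Fin n)) 1) := by
  rw [Measure.addHaar_closedBall _ _ hr, finrank_euclideanSpace, Fintype.card_fin]

/-- The Vitali covering lemma for balls of bounded radii, one centred at each point of a set. -/
theorem exists_countable_disjoint_closedBall_cover (S : Set (EuclideanSpace ℝ (Fin n)))
    (r : EuclideanSpace ℝ (Fin n) → ℝ) (R : ℝ) (hr : ∀ x ∈ S, 0 < r x) (hR : ∀ x ∈ S, r x ≤ R) :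
    ∃ T ⊆ S, T.Countable ∧ (T.PairwiseDisjoint fun x => Metric.closedBall x (r x)) ∧
      S ⊆ ⋃ x ∈ T, Metric.closedBall x (5 * r x) := by
  obtain ⟨T, hTS, hdisj, hcov⟩ := Vitali.exists_disjoint_subfamily_covering_enlargement_closedBall
    S (fun x => x) r R hR 5 (by norm_num)
  refine ⟨T, hTS, hdisj.countable_of_nonempty_interior fun x hx => ?_, hdisj, fun x hx => ?_⟩
  · exact ⟨x, Metric.ball_subset_interior_closedBall (Metric.mem_ball_self (hr x (hTS hx)))⟩
  · obtain ⟨y, hy, hxy⟩ := hcov x hx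
    exact Set.mem_biUnion hy (hxy (Metric.mem_closedBall_self (hr x hx).le))

theorem tsum_setLIntegral_closedBall_le {T : Set (EuclideanSpace ℝ (Fin n))} (hT : T.Countable)
    {r : EuclideanSpace ℝ (Fin n) → ℝ} (hdisj : T.PairwiseDisjoint fun x => Metric.closedBall x (r x))
    (u : EuclideanSpace ℝ (Fin n) → ℝ≥0∞) :
    ∑' x : T, ∫⁻ y in Metric.closedBall (x : EuclideanSpace ℝ (Fin n)) (r x), u y ≤ ∫⁻ y, u y := by
  rw [← lintegral_biUnion hT (fun _ _ => Metric.isClosed_closedBall.measurableSet) hdisj]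
  exact setLIntegral_le_lintegral _ _

/-- The **Hardy–Littlewood maximal inequality** of weak type `(1, 1)`, with averages over balls
centred at `x` written as `t⁻ⁿ ∫_{B(x,t)} u`. -/
theorem mul_volume_exists_lt_setLIntegral_closedBall_le (hn : 1 ≤ n)
    {u : EuclideanSpace ℝ (Fin n) → ℝ≥0∞} (hu : ∫⁻ y, u y ≠ ∞) {c : ℝ} (hc : 0 < c) :
    ENNReal.ofReal c * volume {x : EuclideanSpace ℝ (Fin n) |
        ∃ t : ℝ, 0 < t ∧ ENNReal.ofReal (c * t ^ n) < ∫⁻ y in Metric.closedBall x t, u y}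
      ≤ ENNReal.ofReal (5 ^ n) * volume (Metric.ball (0 : EuclideanSpace ℝ (Fin n)) 1)
        * ∫⁻ y, u y := by
  set S := {x : EuclideanSpace ℝ (Fin n) |
        ∃ t : ℝ, 0 < t ∧ ENNReal.ofReal (c * t ^ n) < ∫⁻ y in Metric.closedBall x t, u y} with hS
  set V := volume (Metric.ball (0 : EuclideanSpace ℝ (Fin n)) 1) with hV
  have hex : ∀ x, ∃ t : ℝ, x ∈ S →
      0 < t ∧ ENNReal.ofReal (c * t ^ n) < ∫⁻ y in Metric.closedBall x t, u y := by
    intro x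
    by_cases hx : x ∈ S
    · obtain ⟨t, ht⟩ := hx
      exact ⟨t, fun _ => ht⟩
    · exact ⟨0, fun h => absurd h hx⟩
  choose r hr using hex
  -- finiteness of `∫ u` bounds the radii, as `n ≥ 1`
  have hbound : ∀ x ∈ S, r x ≤ max 1 ((∫⁻ y, u y).toReal / c) := by
    intro x hx
    obtain ⟨h0, h1⟩ := hr x hx
    by_contra! hlt
    obtain ⟨hlt1, hlt2⟩ := max_lt_iff.1 hlt
    have h2 : ENNReal.ofReal (c * r x ^ n) < ∫⁻ y, u y :=
      h1.trans_le (setLIntegral_le_lintegral _ _)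
    have h3 : c * r x ^ n < (∫⁻ y, u y).toReal :=
      (ENNReal.ofReal_lt_iff_lt_toReal (by positivity) hu).1 h2
    have h4 : r x ≤ r x ^ n := le_self_pow₀ hlt1.le (by omega)
    rw [div_lt_iff₀ hc] at hlt2
    nlinarith
  obtain ⟨T, hTS, hTc, hdisj, hcov⟩ := exists_countable_disjoint_closedBall_cover S r _
    (fun x hx => (hr x hx).1) hbound
  have : Countable T := hTc.to_subtype
  calc ENNReal.ofReal c * volume S
      ≤ ENNReal.ofReal c * ∑' x : T, volume (Metric.closedBall (x : EuclideanSpace ℝ (Fin n))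
          (5 * r x)) := by
        gcongr
        exact (measure_mono hcov).trans (measure_biUnion_le _ hTc _)
    _ = ∑' x : T, ENNReal.ofReal (5 ^ n) * V * ENNReal.ofReal (c * r x ^ n) := by
        rw [← ENNReal.tsum_mul_left]
        refine tsum_congr fun x => ?_
        have h0 := (hr x (hTS x.2)).1
        rw [volume_closedBall_eq _ (by positivity), mul_pow, ENNReal.ofReal_mul (by positivity),
          ENNReal.ofReal_mul hc.le]
        ring
    _ ≤ ∑' x : T, ENNReal.ofReal (5 ^ n) * V *
          ∫⁻ y in Metric.closedBall (x : EuclideanSpace ℝ (Fin n)) (r x), u y := by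
        refine ENNReal.tsum_le_tsum fun x => ?_
        gcongr
        exact (hr x (hTS x.2)).2.le
    _ ≤ ENNReal.ofReal (5 ^ n) * V * ∫⁻ y, u y := by
        rw [ENNReal.tsum_mul_left]
        gcongr
        exact tsum_setLIntegral_closedBall_le hTc hdisj u

end Covering

section MaxAverage

variable {n : ℕ}

/-- The Hardy–Littlewood maximal function of a nonnegative function `u`, normalised as
`sup_{t > 0} t⁻ⁿ ∫_{B(x,t)} u`. -/
def maxAverage (u : EuclideanSpace ℝ (Fin n) → ℝ≥0∞) (x : EuclideanSpace ℝ (Fin n)) : ℝ≥0∞ :=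
  ⨆ (t : ℝ) (_ : 0 < t), ENNReal.ofReal (t ^ n)⁻¹ * ∫⁻ y in Metric.closedBall x t, u y

theorem le_maxAverage (u : EuclideanSpace ℝ (Fin n) → ℝ≥0∞) (x : EuclideanSpace ℝ (Fin n))
    {t : ℝ} (ht : 0 < t) :
    ENNReal.ofReal (t ^ n)⁻¹ * ∫⁻ y in Metric.closedBall x t, u y ≤ maxAverage u x :=
  le_iSup₂_of_le t ht le_rfl

theorem exists_lt_setLIntegral_of_lt_maxAverage {u : EuclideanSpace ℝ (Fin n) → ℝ≥0∞}
    {x : EuclideanSpace ℝ (Fin n)} {c : ℝ} (hc : 0 < c) (h : ENNReal.ofReal c < maxAverage u x) :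
    ∃ t : ℝ, 0 < t ∧ ENNReal.ofReal (c * t ^ n) < ∫⁻ y in Metric.closedBall x t, u y := by
  simp only [maxAverage, lt_iSup_iff] at h
  obtain ⟨t, ht, h⟩ := h
  refine ⟨t, ht, ?_⟩
  have htn : 0 < t ^ n := by positivity
  rw [ENNReal.ofReal_inv_of_pos htn, mul_comm, ← div_eq_mul_inv,
    ENNReal.lt_div_iff_mul_lt (Or.inl (by simpa using htn)) (Or.inl ENNReal.ofReal_ne_top)] at h
  rwa [ENNReal.ofReal_mul hc.le]

/-- The weak-type inequality for `u` truncated from below: only the part of `u` above a fixed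
multiple of the level contributes. -/
theorem mul_volume_lt_maxAverage_le (hn : 1 ≤ n) {u : EuclideanSpace ℝ (Fin n) → ℝ≥0∞}
    (hu : ∫⁻ y, u y ≠ ∞) {κ : ℝ} (hκ : 0 < κ)
    (hκV : ENNReal.ofReal κ * volume (Metric.ball (0 : EuclideanSpace ℝ (Fin n)) 1)
      ≤ ENNReal.ofReal 2⁻¹) {c : ℝ} (hc : 0 < c) :
    ENNReal.ofReal c * volume {x : EuclideanSpace ℝ (Fin n) | ENNReal.ofReal c < maxAverage u x}
      ≤ 2 * (ENNReal.ofReal (5 ^ n) * volume (Metric.ball (0 : EuclideanSpace ℝ (Fin n)) 1))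
        * ∫⁻ y, u y * (if ENNReal.ofReal (κ * c) < u y then 1 else 0) := by
  set v : EuclideanSpace ℝ (Fin n) → ℝ≥0∞ :=
    fun y => u y * (if ENNReal.ofReal (κ * c) < u y then 1 else 0) with hv
  have hvu : ∀ y, v y ≤ u y := fun y => by
    simp only [hv]; split_ifs <;> simp
  have huv : ∀ y, u y ≤ ENNReal.ofReal (κ * c) + v y := fun y => by
    simp only [hv]; split_ifs with h
    · simp
    · simpa using not_lt.1 h
  have hvi : ∫⁻ y, v y ≠ ∞ := ne_top_of_le_ne_top hu (lintegral_mono hvu)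
  have hsub : {x : EuclideanSpace ℝ (Fin n) | ENNReal.ofReal c < maxAverage u x} ⊆
      {x | ∃ t : ℝ, 0 < t ∧
        ENNReal.ofReal (2⁻¹ * c * t ^ n) < ∫⁻ y in Metric.closedBall x t, v y} := by
    intro x hx
    obtain ⟨t, ht, h⟩ := exists_lt_setLIntegral_of_lt_maxAverage hc hx
    refine ⟨t, ht, ?_⟩
    by_contra! hle
    refine absurd h (not_lt.2 ?_)
    calc ∫⁻ y in Metric.closedBall x t, u y
        ≤ ∫⁻ y in Metric.closedBall x t, (ENNReal.ofReal (κ * c) + v y) :=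
          lintegral_mono huv
      _ = ENNReal.ofReal c * ENNReal.ofReal (t ^ n) * (ENNReal.ofReal κ *
            volume (Metric.ball (0 : EuclideanSpace ℝ (Fin n)) 1))
          + ∫⁻ y in Metric.closedBall x t, v y := by
          rw [lintegral_add_left measurable_const, setLIntegral_const,
            volume_closedBall_eq x ht.le, ENNReal.ofReal_mul hκ.le]
          ring
      _ ≤ ENNReal.ofReal c * ENNReal.ofReal (t ^ n) * ENNReal.ofReal 2⁻¹
          + ENNReal.ofReal (2⁻¹ * c * t ^ n) := by gcongr
      _ = ENNReal.ofReal (c * t ^ n) := by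
          rw [← ENNReal.ofReal_mul hc.le, ← ENNReal.ofReal_mul (by positivity),
            ← ENNReal.ofReal_add (by positivity) (by positivity)]
          congr 1; ring
  have hweak := mul_volume_exists_lt_setLIntegral_closedBall_le hn hvi
    (c := 2⁻¹ * c) (by positivity)
  have h2 : ENNReal.ofReal c = 2 * ENNReal.ofReal (2⁻¹ * c) := by
    rw [← ENNReal.ofReal_ofNat 2, ← ENNReal.ofReal_mul zero_le_two]
    congr 1; ring
  calc _ = 2 * (ENNReal.ofReal (2⁻¹ * c) * volume {x : EuclideanSpace ℝ (Fin n) |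
        ENNReal.ofReal c < maxAverage u x}) := by rw [← mul_assoc, ← h2]
    _ ≤ _ := ?_
  rw [mul_assoc 2 (ENNReal.ofReal (5 ^ n) * _)]
  exact mul_le_mul_right ((mul_le_mul_right (measure_mono hsub) _).trans hweak) 2

/-- The local `L log L` bound for the Hardy–Littlewood maximal function. The number of indices `i`
with `κ * (b * 2 ^ i) < u` plays the part of `log₊ (u / b)`. -/
theorem exists_setLIntegral_maxAverage_le (hn : 1 ≤ n) :
    ∃ C : ℝ≥0∞, C ≠ ∞ ∧ ∃ κ : ℝ, 0 < κ ∧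
      ∀ u : EuclideanSpace ℝ (Fin n) → ℝ≥0∞, AEMeasurable u → ∫⁻ y, u y ≠ ∞ →
      ∀ (A : Set (EuclideanSpace ℝ (Fin n))) (b : ℝ), 0 < b →
        ∫⁻ x in A, maxAverage u x ≤ ENNReal.ofReal b * volume A
          + C * ∫⁻ y, u y * ∑' i : ℕ, (if ENNReal.ofReal (κ * (b * 2 ^ i)) < u y then 1 else 0) := by
  set V := volume (Metric.ball (0 : EuclideanSpace ℝ (Fin n)) 1) with hV
  have hVtop : V ≠ ∞ := measure_ball_lt_top.ne
  have hVpos : 0 < V.toReal :=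
    ENNReal.toReal_pos (Metric.measure_ball_pos _ _ one_pos).ne' hVtop
  refine ⟨2 * (ENNReal.ofReal (5 ^ n) * V), by finiteness, (2 * V.toReal)⁻¹, by positivity, ?_⟩
  intro u hum hu A b hb
  have hκV : ENNReal.ofReal (2 * V.toReal)⁻¹ * V ≤ ENNReal.ofReal 2⁻¹ := by
    nth_rw 2 [← ENNReal.ofReal_toReal hVtop]
    rw [← ENNReal.ofReal_mul (by positivity)]
    refine ENNReal.ofReal_le_ofReal (le_of_eq ?_)
    field_simp
  -- the level sets are replaced by measurable hulls
  set S : ℕ → Set (EuclideanSpace ℝ (Fin n)) := fun i =>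
    toMeasurable volume {x | ENNReal.ofReal (b * 2 ^ i) < maxAverage u x} with hS
  have hSm : ∀ i, MeasurableSet (S i) := fun i => measurableSet_toMeasurable _ _
  have hpt : ∀ x, maxAverage u x ≤ ENNReal.ofReal b +
      ∑' i : ℕ, (S i).indicator (fun _ => ENNReal.ofReal (b * 2 ^ i)) x := by
    intro x
    refine (ENNReal.le_add_tsum_levels hb _).trans ?_
    gcongr with i
    split_ifs with h
    · have hx : x ∈ S i := subset_toMeasurable volume _ h
      rw [Set.indicator_of_mem hx]
    · exact zero_le
  calc ∫⁻ x in A, maxAverage u x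
      ≤ ∫⁻ x in A, (ENNReal.ofReal b +
          ∑' i : ℕ, (S i).indicator (fun _ => ENNReal.ofReal (b * 2 ^ i)) x) := lintegral_mono hpt
    _ = ENNReal.ofReal b * volume A +
          ∑' i : ℕ, ∫⁻ x in A, (S i).indicator (fun _ => ENNReal.ofReal (b * 2 ^ i)) x := by
        rw [lintegral_add_left measurable_const, setLIntegral_const, lintegral_tsum]
        exact fun i => (measurable_const.indicator (hSm i)).aemeasurable
    _ ≤ ENNReal.ofReal b * volume A + ∑' i : ℕ, 2 * (ENNReal.ofReal (5 ^ n) * V) *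
          ∫⁻ y, u y * (if ENNReal.ofReal ((2 * V.toReal)⁻¹ * (b * 2 ^ i)) < u y then 1 else 0) := by
        gcongr with i
        refine (setLIntegral_le_lintegral _ _).trans ?_
        rw [lintegral_indicator_const (hSm i), hS, measure_toMeasurable]
        exact mul_volume_lt_maxAverage_le hn hu (by positivity) hκV (by positivity)
    _ = _ := by
        rw [ENNReal.tsum_mul_left, ← lintegral_tsum]
        · simp_rw [ENNReal.tsum_mul_left]
        · intro i
          refine hum.mul ?_
          exact (Measurable.ite (measurableSet_lt measurable_const measurable_id)
            measurable_const measurable_const).comp_aemeasurable hum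

end MaxAverage

/-! ### Kernels and the smooth maximal function -/

section Kernel

variable {𝕜 : Type*} [RCLike 𝕜] {n : ℕ} {φ f : EuclideanSpace ℝ (Fin n) → 𝕜}

theorem IsMaximalKernel.continuous (hφ : IsMaximalKernel φ) : Continuous φ := hφ.1.continuous

theorem IsMaximalKernel.eq_zero (hφ : IsMaximalKernel φ) {x : EuclideanSpace ℝ (Fin n)}
    (hx : 1 ≤ ‖x‖) : φ x = 0 := by
  by_contra h
  have := hφ.2.1 h
  rw [mem_ball_zero_iff] at this
  linarith

theorem IsMaximalKernel.hasCompactSupport (hφ : IsMaximalKernel φ) : HasCompactSupport φ :=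
  HasCompactSupport.of_support_subset_isCompact (isCompact_closedBall 0 1)
    (hφ.2.1.trans Metric.ball_subset_closedBall)

theorem IsMaximalKernel.integrable (hφ : IsMaximalKernel φ) : Integrable φ :=
  hφ.continuous.integrable_of_hasCompactSupport hφ.hasCompactSupport

theorem IsMaximalKernel.exists_bound (hφ : IsMaximalKernel φ) :
    ∃ C : ℝ, 0 < C ∧ (∀ x, ‖φ x‖ ≤ C) ∧ ∀ x y, ‖φ x - φ y‖ ≤ C * ‖x - y‖ := by
  obtain ⟨C₀, hC₀⟩ := hφ.continuous.bounded_above_of_compact_support hφ.hasCompactSupport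
  obtain ⟨C₁, hC₁⟩ := hφ.1.lipschitzWith_of_hasCompactSupport hφ.hasCompactSupport (by simp)
  refine ⟨max C₀ C₁ + 1, ?_, fun x => ?_, fun x y => ?_⟩
  · have : (0 : ℝ) ≤ max C₀ C₁ := le_max_of_le_right C₁.2
    linarith
  · linarith [hC₀ x, le_max_left C₀ (C₁ : ℝ)]
  · refine (hC₁.norm_sub_le x y).trans ?_
    gcongr
    linarith [le_max_right C₀ (C₁ : ℝ)]

theorem IsMaximalKernel.continuous_dilate (hφ : IsMaximalKernel φ) (t : ℝ) :
    Continuous (dilate φ t) :=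
  (hφ.continuous.comp (continuous_const_smul t⁻¹)).const_smul _

theorem IsMaximalKernel.dilate_eq_zero (hφ : IsMaximalKernel φ) {t : ℝ} (ht : 0 < t)
    {x : EuclideanSpace ℝ (Fin n)} (hx : t ≤ ‖x‖) : dilate φ t x = 0 := by
  rw [dilate, hφ.eq_zero, smul_zero]
  rw [norm_smul, norm_inv, Real.norm_of_nonneg ht.le, ← div_eq_inv_mul]
  exact (one_le_div ht).2 hx

theorem IsMaximalKernel.hasCompactSupport_dilate (hφ : IsMaximalKernel φ) {t : ℝ} (ht : 0 < t) :
    HasCompactSupport (dilate φ t) := by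
  refine HasCompactSupport.intro (isCompact_closedBall 0 t) fun x hx => ?_
  refine hφ.dilate_eq_zero ht ?_
  rw [mem_closedBall_zero_iff, not_le] at hx
  exact hx.le

theorem norm_dilate_le {C : ℝ} (hC : ∀ x, ‖φ x‖ ≤ C) {t : ℝ} (ht : 0 < t)
    (x : EuclideanSpace ℝ (Fin n)) : ‖dilate φ t x‖ ≤ C * (t ^ n)⁻¹ := by
  rw [dilate, norm_smul, norm_inv, norm_pow, Real.norm_of_nonneg ht.le, mul_comm]
  gcongr
  exact hC _

theorem norm_dilate_sub_le {C : ℝ} (hC : ∀ x y, ‖φ x - φ y‖ ≤ C * ‖x - y‖) {t : ℝ} (ht : 0 < t)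
    (x y : EuclideanSpace ℝ (Fin n)) :
    ‖dilate φ t x - dilate φ t y‖ ≤ C * (t ^ n)⁻¹ * (‖x - y‖ / t) := by
  rw [dilate, dilate, ← smul_sub, norm_smul, norm_inv, norm_pow, Real.norm_of_nonneg ht.le]
  have := hC (t⁻¹ • x) (t⁻¹ • y)
  rw [← smul_sub, norm_smul, norm_inv, Real.norm_of_nonneg ht.le, ← div_eq_inv_mul] at this
  calc (t ^ n)⁻¹ * ‖φ (t⁻¹ • x) - φ (t⁻¹ • y)‖ ≤ (t ^ n)⁻¹ * (C * (‖x - y‖ / t)) := by gcongr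
    _ = _ := by ring

theorem convolution_dilate_eq (φ f : EuclideanSpace ℝ (Fin n) → 𝕜) (t : ℝ)
    (x : EuclideanSpace ℝ (Fin n)) :
    convolution (dilate φ t) f (ContinuousLinearMap.mul 𝕜 𝕜) volume x
      = ∫ y, dilate φ t (x - y) * f y := by
  rw [convolution_eq_swap]; rfl

theorem IsMaximalKernel.integrable_dilate_mul (hφ : IsMaximalKernel φ) (hf : Integrable f) {t : ℝ}
    (ht : 0 < t) (x : EuclideanSpace ℝ (Fin n)) :
    Integrable fun y => dilate φ t (x - y) * f y := by
  obtain ⟨C, _, hC, _⟩ := hφ.exists_bound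
  refine hf.bdd_mul ?_ (Filter.Eventually.of_forall fun y => norm_dilate_le hC ht (x - y))
  exact ((hφ.continuous_dilate t).comp (continuous_const.sub continuous_id)).aestronglyMeasurable

theorem enorm_convolution_dilate_le_maximalFunction (φ f : EuclideanSpace ℝ (Fin n) → 𝕜) {t : ℝ}
    (ht : 0 < t) (x : EuclideanSpace ℝ (Fin n)) :
    ‖∫ y, dilate φ t (x - y) * f y‖ₑ ≤ maximalFunction φ f x := by
  rw [← convolution_dilate_eq]
  exact le_iSup₂_of_le t ht le_rfl

theorem maximalFunction_le_of_forall {x : EuclideanSpace ℝ (Fin n)} {B : ℝ≥0∞}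
    (h : ∀ t : ℝ, 0 < t → ‖∫ y, dilate φ t (x - y) * f y‖ₑ ≤ B) : maximalFunction φ f x ≤ B :=
  iSup₂_le fun t ht => by rw [convolution_dilate_eq]; exact h t ht

theorem maximalFunction_congr_ae {g : EuclideanSpace ℝ (Fin n) → 𝕜} (h : f =ᵐ[volume] g) :
    maximalFunction φ f = maximalFunction φ g := by
  ext x
  simp only [maximalFunction, convolution_dilate_eq]
  refine iSup_congr fun t => iSup_congr fun _ => congrArg _ (integral_congr_ae ?_)
  filter_upwards [h] with y hy
  rw [hy]

theorem IsMaximalKernel.measurable_maximalFunction (hφ : IsMaximalKernel φ) (hf : Integrable f) :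
    Measurable (maximalFunction φ f) := by
  refine LowerSemicontinuous.measurable ?_
  refine lowerSemicontinuous_biSup fun t ht => Continuous.lowerSemicontinuous ?_
  exact ((hφ.hasCompactSupport_dilate ht).continuous_convolution_left _ (hφ.continuous_dilate t)
    hf.locallyIntegrable).enorm

theorem IsMaximalKernel.enorm_dilate_mul_le (hφ : IsMaximalKernel φ) {C : ℝ}
    (hC : ∀ x, ‖φ x‖ ≤ C) {t : ℝ} (ht : 0 < t) (x y : EuclideanSpace ℝ (Fin n)) :
    ‖dilate φ t (x - y)‖ₑ ≤ ENNReal.ofReal C * (ENNReal.ofReal (t ^ n)⁻¹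
      * (Metric.closedBall x t).indicator 1 y) := by
  by_cases hy : y ∈ Metric.closedBall x t
  · rw [Set.indicator_of_mem hy, Pi.one_apply, mul_one, ← ENNReal.ofReal_mul' (by positivity),
      ← ofReal_norm]
    exact ENNReal.ofReal_le_ofReal (norm_dilate_le hC ht _)
  · rw [hφ.dilate_eq_zero ht]
    · simp
    · rw [Metric.mem_closedBall, not_le, dist_comm, dist_eq_norm] at hy
      exact hy.le

theorem IsMaximalKernel.enorm_integral_dilate_mul_le (hφ : IsMaximalKernel φ) {C : ℝ}
    (hC : ∀ x, ‖φ x‖ ≤ C) {t : ℝ} (ht : 0 < t) (f : EuclideanSpace ℝ (Fin n) → 𝕜)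
    (x : EuclideanSpace ℝ (Fin n)) :
    ‖∫ y, dilate φ t (x - y) * f y‖ₑ ≤ ENNReal.ofReal C * (ENNReal.ofReal (t ^ n)⁻¹
      * ∫⁻ y in Metric.closedBall x t, ‖f y‖ₑ) := by
  refine (enorm_integral_le_lintegral_enorm _).trans ?_
  rw [← lintegral_indicator Metric.isClosed_closedBall.measurableSet,
    ← lintegral_const_mul' _ _ ENNReal.ofReal_ne_top, ← lintegral_const_mul' _ _ ENNReal.ofReal_ne_top]
  refine lintegral_mono fun y => ?_
  rw [enorm_mul]
  refine (mul_le_mul_left (hφ.enorm_dilate_mul_le hC ht x y) _).trans (le_of_eq ?_)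
  by_cases hy : y ∈ Metric.closedBall x t <;> simp [hy, mul_assoc]

theorem IsMaximalKernel.maximalFunction_le_maxAverage (hφ : IsMaximalKernel φ) {C : ℝ}
    (hC : ∀ x, ‖φ x‖ ≤ C) (f : EuclideanSpace ℝ (Fin n) → 𝕜) (x : EuclideanSpace ℝ (Fin n)) :
    maximalFunction φ f x ≤ ENNReal.ofReal C * maxAverage (fun y => ‖f y‖ₑ) x :=
  maximalFunction_le_of_forall fun t ht => (hφ.enorm_integral_dilate_mul_le hC ht f x).trans
    (by gcongr; exact le_maxAverage _ x ht)

end Kernel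

/-! ### Functions with a logarithmic moment belong to the Hardy space -/

section Sufficiency

variable {𝕜 : Type*} [RCLike 𝕜] {n : ℕ} {φ f : EuclideanSpace ℝ (Fin n) → 𝕜}

/-- The weight with which the values of `f` at `y` enter the cancellation estimate for the maximal
function at points of norm about `ρ`. -/
def annulusWeight (ρ : ℝ) (y : EuclideanSpace ℝ (Fin n)) : ℝ :=
  if ‖y‖ < ρ / 2 then ‖y‖ / ρ else 1

/-- The points whose norm is comparable to `ρ`. -/
def fatAnnulus (n : ℕ) (ρ : ℝ) : Set (EuclideanSpace ℝ (Fin n)) :=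
  {y | 2⁻¹ * ρ ≤ ‖y‖ ∧ ‖y‖ < 4 * ρ}

theorem measurableSet_fatAnnulus (ρ : ℝ) : MeasurableSet (fatAnnulus n ρ) :=
  (measurableSet_le measurable_const measurable_norm).inter
    (measurableSet_lt measurable_norm measurable_const)

theorem measurable_annulusWeight (ρ : ℝ) :
    Measurable (annulusWeight ρ : EuclideanSpace ℝ (Fin n) → ℝ) :=
  Measurable.ite (measurableSet_lt measurable_norm measurable_const)
    (measurable_norm.div_const ρ) measurable_const

theorem IsMaximalKernel.norm_dilate_le_of_le_norm (hφ : IsMaximalKernel φ) {C : ℝ} (hC0 : 0 < C)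
    (hC : ∀ x, ‖φ x‖ ≤ C) {t ρ : ℝ} (ht : 0 < t) (hρ : 0 < ρ) {z : EuclideanSpace ℝ (Fin n)}
    (hz : ρ / 2 ≤ ‖z‖) : ‖dilate φ t z‖ ≤ C * 2 ^ n * (ρ ^ n)⁻¹ := by
  rcases le_or_gt t (ρ / 2) with h | h
  · rw [hφ.dilate_eq_zero ht (h.trans hz), norm_zero]
    positivity
  · refine (norm_dilate_le hC ht z).trans ?_
    have h1 : (t ^ n)⁻¹ ≤ ((ρ / 2) ^ n)⁻¹ := by gcongr
    calc C * (t ^ n)⁻¹ ≤ C * ((ρ / 2) ^ n)⁻¹ := by gcongr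
      _ = _ := by rw [div_pow, inv_div]; ring

theorem IsMaximalKernel.norm_dilate_sub_le_of_le_norm (hφ : IsMaximalKernel φ) {C : ℝ} (hC0 : 0 < C)
    (hC : ∀ x y, ‖φ x - φ y‖ ≤ C * ‖x - y‖) {t ρ : ℝ} (ht : 0 < t) (hρ : 0 < ρ)
    {z w : EuclideanSpace ℝ (Fin n)} (hz : ρ / 2 ≤ ‖z‖) (hw : ρ / 2 ≤ ‖w‖) :
    ‖dilate φ t z - dilate φ t w‖ ≤ C * 2 ^ (n + 1) * (ρ ^ n)⁻¹ * (‖z - w‖ / ρ) := by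
  rcases le_or_gt t (ρ / 2) with h | h
  · rw [hφ.dilate_eq_zero ht (h.trans hz), hφ.dilate_eq_zero ht (h.trans hw), sub_zero, norm_zero]
    positivity
  · refine (norm_dilate_sub_le hC ht z w).trans ?_
    have h1 : (t ^ n)⁻¹ ≤ ((ρ / 2) ^ n)⁻¹ := by gcongr
    have h2 : ‖z - w‖ / t ≤ ‖z - w‖ / (ρ / 2) := by gcongr
    calc C * (t ^ n)⁻¹ * (‖z - w‖ / t) ≤ C * ((ρ / 2) ^ n)⁻¹ * (‖z - w‖ / (ρ / 2)) := by gcongr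
      _ = _ := by rw [div_pow, inv_div]; field_simp; ring

/-- For `‖x‖` about `ρ`, the kernel `φ_t(x - y) - φ_t(x)` is small for `‖y‖` much smaller than `ρ`
by smoothness, and at most `ρ⁻ⁿ` up to a constant for `‖y‖` much larger, by the support
condition. -/
theorem IsMaximalKernel.enorm_dilate_sub_le_annulus (hφ : IsMaximalKernel φ) {C : ℝ} (hC0 : 0 < C)
    (hC : ∀ x, ‖φ x‖ ≤ C) (hC' : ∀ x y, ‖φ x - φ y‖ ≤ C * ‖x - y‖) {t ρ : ℝ} (ht : 0 < t)
    (hρ : 0 < ρ) {x : EuclideanSpace ℝ (Fin n)} (hx : ρ ≤ ‖x‖) (hx' : ‖x‖ < 2 * ρ)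
    (y : EuclideanSpace ℝ (Fin n)) :
    ‖dilate φ t (x - y) - dilate φ t x‖ₑ
      ≤ ENNReal.ofReal (C * 2 ^ (n + 1) * (ρ ^ n)⁻¹) * ENNReal.ofReal (annulusWeight ρ y)
        + ENNReal.ofReal C * (ENNReal.ofReal (t ^ n)⁻¹ * (Metric.closedBall x t).indicator 1 y)
          * (fatAnnulus n ρ).indicator 1 y := by
  rw [← ENNReal.ofReal_mul (by positivity)]
  by_cases hnear : ‖y‖ < ρ / 2
  · refine le_add_right ?_
    rw [← ofReal_norm, annulusWeight, if_pos hnear]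
    refine ENNReal.ofReal_le_ofReal ?_
    have h1 : ‖x‖ - ‖y‖ ≤ ‖x - y‖ := norm_sub_norm_le x y
    have := hφ.norm_dilate_sub_le_of_le_norm hC0 hC' ht hρ (z := x - y) (w := x)
      (by linarith) (by linarith)
    rwa [show x - y - x = -y by abel, norm_neg] at this
  have hx2 : ‖dilate φ t x‖ ≤ C * 2 ^ n * (ρ ^ n)⁻¹ :=
    hφ.norm_dilate_le_of_le_norm hC0 hC ht hρ (by linarith)
  rw [annulusWeight, if_neg hnear, mul_one]
  by_cases hfar : ‖y‖ < 4 * ρ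
  · have hmem : y ∈ fatAnnulus n ρ := ⟨by linarith, hfar⟩
    rw [Set.indicator_of_mem hmem, Pi.one_apply, mul_one, add_comm]
    refine (enorm_sub_le).trans (add_le_add (hφ.enorm_dilate_mul_le hC ht x y) ?_)
    rw [← ofReal_norm]
    refine ENNReal.ofReal_le_ofReal (hx2.trans ?_)
    have : 0 ≤ C * 2 ^ n * (ρ ^ n)⁻¹ := by positivity
    rw [pow_succ]
    linarith
  · refine le_add_right ?_
    rw [← ofReal_norm]
    refine ENNReal.ofReal_le_ofReal ?_
    have h1 : ‖y‖ - ‖x‖ ≤ ‖x - y‖ := by rw [norm_sub_rev]; exact norm_sub_norm_le y x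
    have := hφ.norm_dilate_le_of_le_norm hC0 hC ht hρ (z := x - y) (by linarith)
    refine (norm_sub_le _ _).trans ?_
    rw [pow_succ]
    linarith

theorem IsMaximalKernel.maximalFunction_le_annulus (hφ : IsMaximalKernel φ) {C : ℝ} (hC0 : 0 < C)
    (hC : ∀ x, ‖φ x‖ ≤ C) (hC' : ∀ x y, ‖φ x - φ y‖ ≤ C * ‖x - y‖) (hf : Integrable f)
    (hf0 : ∫ y, f y = 0) {ρ : ℝ} (hρ : 0 < ρ) {x : EuclideanSpace ℝ (Fin n)} (hx : ρ ≤ ‖x‖)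
    (hx' : ‖x‖ < 2 * ρ) :
    maximalFunction φ f x ≤ ENNReal.ofReal (C * 2 ^ (n + 1) * (ρ ^ n)⁻¹)
        * (∫⁻ y, ENNReal.ofReal (annulusWeight ρ y) * ‖f y‖ₑ)
      + ENNReal.ofReal C * maxAverage ((fatAnnulus n ρ).indicator fun y => ‖f y‖ₑ) x := by
  refine maximalFunction_le_of_forall fun t ht => ?_
  -- the mean value zero of `f` allows subtracting the constant `φ_t(x)` from the kernel
  have h1 : ∫ y, dilate φ t (x - y) * f y = ∫ y, (dilate φ t (x - y) - dilate φ t x) * f y := by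
    simp_rw [sub_mul]
    rw [integral_sub (hφ.integrable_dilate_mul hf ht x) (hf.const_mul _), integral_const_mul, hf0]
    simp
  rw [h1]
  refine (enorm_integral_le_lintegral_enorm _).trans ?_
  have hW : AEMeasurable fun y => ENNReal.ofReal (annulusWeight ρ y) * ‖f y‖ₑ :=
    (measurable_annulusWeight ρ).ennreal_ofReal.aemeasurable.mul hf.1.enorm
  calc ∫⁻ y, ‖(dilate φ t (x - y) - dilate φ t x) * f y‖ₑ
      ≤ ∫⁻ y, (ENNReal.ofReal (C * 2 ^ (n + 1) * (ρ ^ n)⁻¹)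
          * (ENNReal.ofReal (annulusWeight ρ y) * ‖f y‖ₑ)
        + ENNReal.ofReal C * (ENNReal.ofReal (t ^ n)⁻¹ * (Metric.closedBall x t).indicator
            ((fatAnnulus n ρ).indicator fun y => ‖f y‖ₑ) y)) := by
        refine lintegral_mono fun y => ?_
        rw [enorm_mul]
        refine (mul_le_mul_left (hφ.enorm_dilate_sub_le_annulus hC0 hC hC' ht hρ hx hx' y)
          _).trans (le_of_eq ?_)
        by_cases h1 : y ∈ Metric.closedBall x t <;> by_cases h2 : y ∈ fatAnnulus n ρ <;>
          simp only [h1, h2, Set.indicator_of_mem, Set.indicator_of_notMem, not_false_eq_true,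
            Pi.one_apply] <;> ring
    _ = ENNReal.ofReal (C * 2 ^ (n + 1) * (ρ ^ n)⁻¹)
          * (∫⁻ y, ENNReal.ofReal (annulusWeight ρ y) * ‖f y‖ₑ)
        + ENNReal.ofReal C * (ENNReal.ofReal (t ^ n)⁻¹ * ∫⁻ y in Metric.closedBall x t,
            (fatAnnulus n ρ).indicator (fun y => ‖f y‖ₑ) y) := by
        rw [lintegral_add_left' (hW.const_mul _), lintegral_const_mul' _ _ ENNReal.ofReal_ne_top,
          lintegral_const_mul' _ _ ENNReal.ofReal_ne_top,
          lintegral_const_mul' _ _ ENNReal.ofReal_ne_top,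
          lintegral_indicator Metric.isClosed_closedBall.measurableSet]
    _ ≤ _ := by gcongr; exact le_maxAverage _ x ht

theorem lintegral_enorm_mul_lt_top (hf : Integrable f)
    (hlog : ∫⁻ x, ‖f x‖ₑ * ENNReal.ofReal (Real.posLog ‖f x‖ + Real.posLog ‖x‖) < ∞)
    {W : EuclideanSpace ℝ (Fin n) → ℝ≥0∞} {a b : ℝ≥0∞} (ha : a ≠ ∞) (hb : b ≠ ∞)
    (hW : ∀ y, W y ≤ a + b * ENNReal.ofReal (Real.posLog ‖f y‖ + Real.posLog ‖y‖)) :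
    ∫⁻ y, ‖f y‖ₑ * W y < ∞ := by
  calc ∫⁻ y, ‖f y‖ₑ * W y ≤ ∫⁻ y, (a * ‖f y‖ₑ
        + b * (‖f y‖ₑ * ENNReal.ofReal (Real.posLog ‖f y‖ + Real.posLog ‖y‖))) := by
        refine lintegral_mono fun y => (mul_le_mul_right (hW y) _).trans (le_of_eq ?_)
        ring
    _ = a * (∫⁻ y, ‖f y‖ₑ)
        + b * ∫⁻ y, ‖f y‖ₑ * ENNReal.ofReal (Real.posLog ‖f y‖ + Real.posLog ‖y‖) := by
        rw [lintegral_add_left' (hf.1.enorm.const_mul _), lintegral_const_mul' _ _ ha,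
          lintegral_const_mul' _ _ hb]
    _ < ∞ := ENNReal.add_lt_top.2 ⟨ENNReal.mul_lt_top ha.lt_top hf.2,
        ENNReal.mul_lt_top hb.lt_top hlog⟩

theorem tsum_annulusWeight_le (y : EuclideanSpace ℝ (Fin n)) :
    ∑' j : ℕ, ENNReal.ofReal (annulusWeight (2 ^ j) y)
      ≤ (1 - ENNReal.ofReal 2⁻¹)⁻¹ + (1 + ENNReal.ofReal (Real.posLog (‖y‖ / 4⁻¹) / Real.log 2)) := by
  refine le_trans ?_ (add_le_add (tsum_ite_div_mul_pow_le (b := 1) (z := ‖y‖) one_lt_two one_pos)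
    (tsum_ite_mul_pow_lt_le (b := 4⁻¹) one_lt_two (by norm_num) (norm_nonneg y)))
  rw [← ENNReal.tsum_add]
  refine ENNReal.tsum_le_tsum fun j => ?_
  have hj : (0 : ℝ) < 2 ^ j := by positivity
  unfold annulusWeight
  by_cases h : ‖y‖ < 2 ^ j / 2
  · rw [if_pos h, one_mul, if_pos (by linarith)]
    exact le_self_add
  · rw [if_neg h, ENNReal.ofReal_one, if_pos (show 4⁻¹ * 2 ^ j < ‖y‖ by linarith)]
    exact le_add_self

theorem posLog_div_le {κ : ℝ} {j : ℕ} {s r : ℝ} (hκ : 0 < κ)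
    (hr : 2⁻¹ * 2 ^ j ≤ r) :
    Real.posLog (s / (κ * ((2 : ℝ) ^ (j * (n + 1)))⁻¹)) ≤ Real.posLog s
      + ((n + 1) * (Real.log 2 + Real.posLog r) + Real.posLog κ⁻¹) := by
  have h1 : s / (κ * ((2 : ℝ) ^ (j * (n + 1)))⁻¹) = s * ((2 ^ j) ^ (n + 1) * κ⁻¹) := by
    rw [← pow_mul]; field_simp
  have h2 : Real.posLog ((2 : ℝ) ^ j) ≤ Real.log 2 + Real.posLog r := by
    have h3 := Real.posLog_nat_mul (n := 2) (x := r)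
    rw [Nat.cast_ofNat] at h3
    exact (Real.posLog_le_posLog (by positivity) (by linarith)).trans h3
  rw [h1]
  refine Real.posLog_mul.trans ?_
  gcongr
  refine Real.posLog_mul.trans ?_
  rw [Real.posLog_pow]
  push_cast
  gcongr

/-- If `f` has mean value zero and `|f| (ln₊ |f| + ln₊ |x|)` is integrable, then `M_φ f` is
integrable for every kernel `φ`. The unit ball and the dyadic annuli `2 ^ j ≤ ‖x‖ < 2 ^ (j + 1)`
are treated separately; on the `j`-th annulus the `L log L` bound is applied at the level
`2 ^ (-j (n + 1))`, which makes the errors summable and costs only a logarithm of `‖y‖`. -/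
theorem IsMaximalKernel.lintegral_maximalFunction_lt_top (hn : 1 ≤ n) (hφ : IsMaximalKernel φ)
    (hf : Integrable f) (hf0 : ∫ y, f y = 0)
    (hlog : ∫⁻ x, ‖f x‖ₑ * ENNReal.ofReal (Real.posLog ‖f x‖ + Real.posLog ‖x‖) < ∞) :
    ∫⁻ x, maximalFunction φ f x < ∞ := by
  obtain ⟨C, hC0, hC, hC'⟩ := hφ.exists_bound
  obtain ⟨D, hD, κ, hκ, hLlogL⟩ := exists_setLIntegral_maxAverage_le hn
  set V := volume (Metric.ball (0 : EuclideanSpace ℝ (Fin n)) 1) with hV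
  have hVtop : V ≠ ∞ := measure_ball_lt_top.ne
  have hl2 : 0 < Real.log 2 := Real.log_pos one_lt_two
  set A : ℕ → Set (EuclideanSpace ℝ (Fin n)) := fun j => {x | 2 ^ j ≤ ‖x‖ ∧ ‖x‖ < 2 * 2 ^ j} with hA
  have hcover : (Set.univ : Set (EuclideanSpace ℝ (Fin n))) ⊆ Metric.ball 0 1 ∪ ⋃ j, A j := by
    intro x _
    rcases lt_or_ge ‖x‖ 1 with h | h
    · exact Or.inl (mem_ball_zero_iff.2 h)
    · obtain ⟨j, hj, hj'⟩ := exists_nat_pow_near h one_lt_two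
      exact Or.inr (Set.mem_iUnion.2 ⟨j, hj, by rwa [pow_succ'] at hj'⟩)
  have hfin : ∫⁻ y, ‖f y‖ₑ ≠ ∞ := hf.2.ne
  -- the unit ball
  have hball : ∫⁻ x in Metric.ball 0 1, maximalFunction φ f x < ∞ := by
    calc ∫⁻ x in Metric.ball 0 1, maximalFunction φ f x
        ≤ ∫⁻ x in Metric.ball 0 1, ENNReal.ofReal C * maxAverage (fun y => ‖f y‖ₑ) x :=
          lintegral_mono fun x => hφ.maximalFunction_le_maxAverage hC f x
      _ = ENNReal.ofReal C * ∫⁻ x in Metric.ball 0 1, maxAverage (fun y => ‖f y‖ₑ) x :=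
          lintegral_const_mul' _ _ ENNReal.ofReal_ne_top
      _ < ∞ := by
        refine ENNReal.mul_lt_top ENNReal.ofReal_lt_top
          ((hLlogL _ hf.1.enorm hfin _ 1 one_pos).trans_lt ?_)
        refine ENNReal.add_lt_top.2 ⟨ENNReal.mul_lt_top ENNReal.ofReal_lt_top hVtop.lt_top,
          ENNReal.mul_lt_top hD.lt_top ?_⟩
        refine lintegral_enorm_mul_lt_top hf hlog
          (a := 1 + ENNReal.ofReal (Real.posLog κ⁻¹ / Real.log 2))
          (b := ENNReal.ofReal (Real.log 2)⁻¹) (by finiteness) (by finiteness) fun y => ?_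
        simp_rw [one_mul, ← ofReal_norm, ENNReal.ofReal_lt_ofReal_iff_of_nonneg
          (mul_nonneg hκ.le (pow_nonneg zero_le_two _))]
        refine (tsum_ite_mul_pow_lt_le one_lt_two hκ (norm_nonneg _)).trans ?_
        rw [add_assoc, ← ENNReal.ofReal_mul (by positivity), ← ENNReal.ofReal_add
          (div_nonneg Real.posLog_nonneg hl2.le)
          (mul_nonneg (by positivity) (add_nonneg Real.posLog_nonneg Real.posLog_nonneg))]
        gcongr
        have h1 : Real.posLog (‖f y‖ / κ) ≤ Real.posLog ‖f y‖ + Real.posLog κ⁻¹ := by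
          rw [div_eq_mul_inv]; exact Real.posLog_mul
        have h2 := Real.posLog_nonneg (x := ‖y‖)
        rw [← div_eq_inv_mul, ← add_div]
        gcongr
        linarith
  -- one dyadic annulus
  set P : EuclideanSpace ℝ (Fin n) → ℝ≥0∞ := fun y => 1 + ENNReal.ofReal ((Real.posLog ‖f y‖
      + ((n + 1) * (Real.log 2 + Real.posLog ‖y‖) + Real.posLog κ⁻¹)) / Real.log 2) with hP
  have hann : ∀ j, ∫⁻ x in A j, maximalFunction φ f x ≤
      ENNReal.ofReal (C * 2 ^ (n + 1) * 2 ^ n) * V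
          * (∫⁻ y, ENNReal.ofReal (annulusWeight (2 ^ j) y) * ‖f y‖ₑ)
        + ENNReal.ofReal C * (ENNReal.ofReal (2 ^ n) * V * 2⁻¹ ^ j
          + D * ∫⁻ y, ‖f y‖ₑ * ((fatAnnulus n (2 ^ j)).indicator 1 y * P y)) := by
    intro j
    have hj : (0 : ℝ) < 2 ^ j := by positivity
    have hAvol : volume (A j) ≤ ENNReal.ofReal ((2 * 2 ^ j) ^ n) * V := by
      rw [hV, ← volume_closedBall_eq (0 : EuclideanSpace ℝ (Fin n)) (by positivity)]
      exact measure_mono fun x hx => mem_closedBall_zero_iff.2 hx.2.le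
    have hAm : MeasurableSet (A j) := (measurableSet_le measurable_const measurable_norm).inter
      (measurableSet_lt measurable_norm measurable_const)
    set u := (fatAnnulus n (2 ^ j)).indicator (fun y => ‖f y‖ₑ) with hu
    have huf : ∫⁻ y, u y ≠ ∞ := ne_top_of_le_ne_top hfin
      (lintegral_mono fun y => Set.indicator_le_self _ _ y)
    have hum : AEMeasurable u := hf.1.enorm.indicator (measurableSet_fatAnnulus _)
    have hb : (0 : ℝ) < (2 ^ (j * (n + 1)))⁻¹ := by positivity
    calc ∫⁻ x in A j, maximalFunction φ f x
        ≤ ∫⁻ x in A j, (ENNReal.ofReal (C * 2 ^ (n + 1) * ((2 ^ j) ^ n)⁻¹)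
            * (∫⁻ y, ENNReal.ofReal (annulusWeight (2 ^ j) y) * ‖f y‖ₑ)
            + ENNReal.ofReal C * maxAverage u x) :=
          setLIntegral_mono' hAm fun x hx =>
            hφ.maximalFunction_le_annulus hC0 hC hC' hf hf0 hj hx.1 hx.2
      _ = ENNReal.ofReal (C * 2 ^ (n + 1) * ((2 ^ j) ^ n)⁻¹)
            * (∫⁻ y, ENNReal.ofReal (annulusWeight (2 ^ j) y) * ‖f y‖ₑ) * volume (A j)
            + ENNReal.ofReal C * ∫⁻ x in A j, maxAverage u x := by
          rw [lintegral_add_left measurable_const, setLIntegral_const,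
            lintegral_const_mul' _ _ ENNReal.ofReal_ne_top]
      _ ≤ ENNReal.ofReal (C * 2 ^ (n + 1) * ((2 ^ j) ^ n)⁻¹)
            * (∫⁻ y, ENNReal.ofReal (annulusWeight (2 ^ j) y) * ‖f y‖ₑ)
              * (ENNReal.ofReal ((2 * 2 ^ j) ^ n) * V)
            + ENNReal.ofReal C * (ENNReal.ofReal (2 ^ (j * (n + 1)))⁻¹
                * (ENNReal.ofReal ((2 * 2 ^ j) ^ n) * V)
              + D * ∫⁻ y, ‖f y‖ₑ * ((fatAnnulus n (2 ^ j)).indicator 1 y * P y)) := by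
          refine add_le_add (mul_le_mul_right hAvol _) (mul_le_mul_right ?_ _)
          refine (hLlogL u hum huf (A j) _ hb).trans ?_
          refine add_le_add (mul_le_mul_right hAvol _) (mul_le_mul_right (lintegral_mono fun y => ?_) _)
          by_cases hy : y ∈ fatAnnulus n (2 ^ j)
          · have huy : u y = ‖f y‖ₑ := Set.indicator_of_mem hy _
            rw [huy, Set.indicator_of_mem hy, Pi.one_apply, one_mul]
            refine mul_le_mul_right ?_ _
            simp_rw [← mul_assoc, ← ofReal_norm, ENNReal.ofReal_lt_ofReal_iff_of_nonneg
              (mul_nonneg (mul_nonneg hκ.le hb.le) (pow_nonneg zero_le_two _))]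
            refine (tsum_ite_mul_pow_lt_le one_lt_two (mul_pos hκ hb) (norm_nonneg _)).trans ?_
            refine add_le_add le_rfl (ENNReal.ofReal_le_ofReal ?_)
            exact div_le_div_of_nonneg_right (posLog_div_le hκ hy.1) hl2.le
          · have huy : u y = 0 := Set.indicator_of_notMem hy _
            rw [huy, zero_mul]
            exact zero_le
      _ = _ := by
          have e1 : ENNReal.ofReal (C * 2 ^ (n + 1) * ((2 ^ j) ^ n)⁻¹)
              * ENNReal.ofReal ((2 * 2 ^ j) ^ n) = ENNReal.ofReal (C * 2 ^ (n + 1) * 2 ^ n) := by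
            rw [← ENNReal.ofReal_mul (by positivity), mul_pow]
            congr 1; field_simp
          have e2 : ENNReal.ofReal (2 ^ (j * (n + 1)))⁻¹ * ENNReal.ofReal ((2 * 2 ^ j) ^ n)
              = ENNReal.ofReal (2 ^ n) * 2⁻¹ ^ j := by
            rw [← ENNReal.ofReal_ofNat 2, ← ENNReal.ofReal_inv_of_pos two_pos,
              ← ENNReal.ofReal_pow (by norm_num), ← ENNReal.ofReal_mul (by positivity),
              ← ENNReal.ofReal_mul (by positivity)]
            congr 1
            rw [mul_pow, inv_pow, mul_add, mul_one, pow_add, pow_mul]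
            field_simp
          rw [← e1, mul_right_comm (ENNReal.ofReal (2 ^ n)), ← e2]
          ring
  have hsum1 : ∑' j : ℕ, ∫⁻ y, ENNReal.ofReal (annulusWeight (2 ^ j) y) * ‖f y‖ₑ < ∞ := by
    have hm : ∀ j : ℕ, AEMeasurable (fun y => ENNReal.ofReal (annulusWeight (2 ^ j) y) * ‖f y‖ₑ) :=
      fun j => (measurable_annulusWeight _).ennreal_ofReal.aemeasurable.mul hf.1.enorm
    rw [← lintegral_tsum hm]
    simp_rw [ENNReal.tsum_mul_right, mul_comm _ (‖f _‖ₑ)]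
    refine lintegral_enorm_mul_lt_top hf hlog
      (a := (1 - ENNReal.ofReal 2⁻¹)⁻¹ + (1 + ENNReal.ofReal (Real.posLog 4 / Real.log 2)))
      (b := ENNReal.ofReal (Real.log 2)⁻¹) ?_ (by finiteness) fun y => ?_
    · have : (1 : ℝ≥0∞) - ENNReal.ofReal 2⁻¹ ≠ 0 := by
        refine (tsub_pos_of_lt (ENNReal.ofReal_lt_one.2 ?_)).ne'
        norm_num
      finiteness
    · refine (tsum_annulusWeight_le y).trans ?_
      rw [add_assoc, add_assoc, ← ENNReal.ofReal_mul (by positivity), ← ENNReal.ofReal_add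
          (div_nonneg Real.posLog_nonneg hl2.le)
          (mul_nonneg (by positivity) (add_nonneg Real.posLog_nonneg Real.posLog_nonneg))]
      gcongr
      have h1 : Real.posLog (‖y‖ / 4⁻¹) ≤ Real.posLog ‖y‖ + Real.posLog 4 := by
        rw [div_inv_eq_mul]; exact Real.posLog_mul
      have h2 := Real.posLog_nonneg (x := ‖f y‖)
      rw [← div_eq_inv_mul, ← add_div]
      gcongr
      linarith
  have hsum2 : ∑' j : ℕ, ∫⁻ y, ‖f y‖ₑ * ((fatAnnulus n (2 ^ j)).indicator 1 y * P y) < ∞ := by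
    have hPm : AEMeasurable P := by
      have : AEMeasurable fun y => Real.posLog ‖f y‖ :=
        Real.continuous_posLog.measurable.comp_aemeasurable hf.1.norm.aemeasurable
      have h2 : Measurable fun y : EuclideanSpace ℝ (Fin n) => Real.posLog ‖y‖ :=
        Real.continuous_posLog.measurable.comp measurable_norm
      exact ((((this.add (((h2.const_add _).const_mul _).add_const _).aemeasurable)).div_const
        _).ennreal_ofReal).const_add _
    have hm : ∀ j : ℕ, AEMeasurable
        (fun y => ‖f y‖ₑ * ((fatAnnulus n (2 ^ j)).indicator 1 y * P y)) := fun j => hf.1.enorm.mul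
      ((measurable_one.indicator (measurableSet_fatAnnulus _)).aemeasurable.mul hPm)
    rw [← lintegral_tsum hm]
    simp_rw [ENNReal.tsum_mul_left, ENNReal.tsum_mul_right]
    refine lintegral_enorm_mul_lt_top hf hlog
      (a := 3 * (1 + ENNReal.ofReal (((n + 1) * Real.log 2 + Real.posLog κ⁻¹) / Real.log 2)))
      (b := 3 * ENNReal.ofReal ((n + 1) / Real.log 2)) (by finiteness) (by finiteness) fun y => ?_
    have hcount : ∑' j : ℕ, (fatAnnulus n (2 ^ j)).indicator (1 : EuclideanSpace ℝ (Fin n) → ℝ≥0∞) y ≤ 3 := by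
      have := tsum_ite_window_le (a := 2) (p := 2⁻¹) (q := 4) (z := ‖y‖) (m := 3) one_lt_two
        (by norm_num) (by norm_num)
      refine le_trans (le_of_eq (tsum_congr fun j => ?_)) this
      simp only [Set.indicator_apply, fatAnnulus, Set.mem_ofPred_eq, Pi.one_apply]
    refine (mul_le_mul_left hcount _).trans ?_
    rw [mul_assoc, ← mul_add, hP, add_assoc]
    have h1 := Real.posLog_nonneg (x := ‖f y‖)
    have h2 := Real.posLog_nonneg (x := ‖y‖)
    have h3 := Real.posLog_nonneg (x := κ⁻¹)
    rw [← ENNReal.ofReal_mul (by positivity), ← ENNReal.ofReal_add (by positivity) (by positivity)]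
    refine mul_le_mul_right (add_le_add le_rfl (ENNReal.ofReal_le_ofReal ?_)) _
    rw [div_mul_eq_mul_div, ← add_div]
    refine div_le_div_of_nonneg_right ?_ hl2.le
    have : 0 ≤ n * Real.posLog ‖f y‖ := by positivity
    linarith
  have hsum3 : ∑' j : ℕ, (2⁻¹ : ℝ≥0∞) ^ j < ∞ := by
    rw [ENNReal.tsum_geometric, ENNReal.one_sub_inv_two, inv_inv]
    exact ENNReal.ofNat_lt_top
  calc ∫⁻ x, maximalFunction φ f x
      = ∫⁻ x in Set.univ, maximalFunction φ f x := (setLIntegral_univ _).symm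
    _ ≤ ∫⁻ x in Metric.ball 0 1 ∪ ⋃ j, A j, maximalFunction φ f x := lintegral_mono_set hcover
    _ ≤ (∫⁻ x in Metric.ball 0 1, maximalFunction φ f x)
        + ∑' j, ∫⁻ x in A j, maximalFunction φ f x :=
        (lintegral_union_le _ _ _).trans (add_le_add le_rfl (lintegral_iUnion_le _ _))
    _ < ∞ := by
        refine ENNReal.add_lt_top.2 ⟨hball, (ENNReal.tsum_le_tsum hann).trans_lt ?_⟩
        rw [ENNReal.tsum_add, ENNReal.tsum_mul_left, ENNReal.tsum_mul_left, ENNReal.tsum_add,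
          ENNReal.tsum_mul_left, ENNReal.tsum_mul_left]
        finiteness [hsum1.ne, hsum2.ne, hsum3.ne]

/-- A kernel: a radial bump function with values in `[0, 1]`. -/
theorem exists_isMaximalKernel (𝕜 : Type*) [RCLike 𝕜] (n : ℕ) :
    ∃ φ : EuclideanSpace ℝ (Fin n) → 𝕜, IsMaximalKernel φ := by
  let b : ContDiffBump (0 : EuclideanSpace ℝ (Fin n)) := ⟨2⁻¹, 1, by norm_num, by norm_num⟩
  refine ⟨fun x => ((b x : ℝ) : 𝕜), ?_, ?_, ?_⟩
  · exact (RCLike.ofRealCLM (K := 𝕜)).contDiff.comp b.contDiff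
  · intro x hx
    have : x ∈ Function.support b := by
      rw [Function.mem_support] at hx ⊢
      exact fun h => hx (by rw [h, RCLike.ofReal_zero])
    rwa [b.support_eq] at this
  · rw [integral_ofReal]
    exact RCLike.ofReal_ne_zero.2 b.integral_pos.ne'

end Sufficiency

/-! ### Testing a convolution with an oscillating kernel against a cutoff -/

section LowerBound

variable {𝕜 : Type*} [RCLike 𝕜] {n : ℕ} {φ f : EuclideanSpace ℝ (Fin n) → 𝕜}

/-- The Lipschitz cutoff equal to `1` on the ball of radius `t` about `x₀` and vanishing off the
ball of radius `2 t`. -/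
def ramp (x₀ : EuclideanSpace ℝ (Fin n)) (t : ℝ) (x : EuclideanSpace ℝ (Fin n)) : ℝ :=
  max 0 (min 1 (2 - ‖x - x₀‖ / t))

theorem ramp_nonneg (x₀ : EuclideanSpace ℝ (Fin n)) (t : ℝ) (x : EuclideanSpace ℝ (Fin n)) :
    0 ≤ ramp x₀ t x := le_max_left _ _

theorem ramp_le_one (x₀ : EuclideanSpace ℝ (Fin n)) (t : ℝ) (x : EuclideanSpace ℝ (Fin n)) :
    ramp x₀ t x ≤ 1 := max_le zero_le_one (min_le_left _ _)

theorem continuous_ramp (x₀ : EuclideanSpace ℝ (Fin n)) (t : ℝ) : Continuous (ramp x₀ t) := by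
  unfold ramp
  fun_prop

theorem ramp_eq_one {x₀ : EuclideanSpace ℝ (Fin n)} {t : ℝ} (ht : 0 < t)
    {x : EuclideanSpace ℝ (Fin n)} (hx : ‖x - x₀‖ ≤ t) : ramp x₀ t x = 1 := by
  have : ‖x - x₀‖ / t ≤ 1 := (div_le_one ht).2 hx
  rw [ramp, min_eq_left (by linarith), max_eq_right zero_le_one]

theorem ramp_eq_zero {x₀ : EuclideanSpace ℝ (Fin n)} {t : ℝ} (ht : 0 < t)
    {x : EuclideanSpace ℝ (Fin n)} (hx : 2 * t ≤ ‖x - x₀‖) : ramp x₀ t x = 0 := by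
  have : 2 ≤ ‖x - x₀‖ / t := (le_div_iff₀ ht).2 hx
  rw [ramp, max_eq_left ((min_le_right _ _).trans (by linarith))]

theorem abs_ramp_sub_le {x₀ : EuclideanSpace ℝ (Fin n)} {t : ℝ} (ht : 0 < t)
    (x y : EuclideanSpace ℝ (Fin n)) : |ramp x₀ t x - ramp x₀ t y| ≤ ‖x - y‖ / t := by
  have h1 : |ramp x₀ t x - ramp x₀ t y| ≤ |‖x - x₀‖ / t - ‖y - x₀‖ / t| := by
    unfold ramp
    refine (abs_max_sub_max_le_max _ _ _ _).trans ?_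
    rw [sub_self, abs_zero, max_eq_right (abs_nonneg _)]
    refine (abs_min_sub_min_le_max _ _ _ _).trans ?_
    rw [sub_self, abs_zero, max_eq_right (abs_nonneg _), sub_sub_sub_cancel_left, abs_sub_comm]
  refine h1.trans ?_
  rw [← sub_div, abs_div, abs_of_pos ht]
  gcongr
  refine (abs_norm_sub_norm_le _ _).trans (le_of_eq ?_)
  congr 1; abel

theorem integral_dilate (φ : EuclideanSpace ℝ (Fin n) → 𝕜) {s : ℝ} (hs : 0 < s) :
    ∫ x, dilate φ s x = ∫ x, φ x := by
  unfold dilate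
  rw [integral_smul, Measure.integral_comp_inv_smul, finrank_euclideanSpace, Fintype.card_fin,
    abs_of_pos (by positivity), inv_smul_smul₀ (by positivity)]

theorem integral_norm_dilate (φ : EuclideanSpace ℝ (Fin n) → 𝕜) {s : ℝ} (hs : 0 < s) :
    ∫ x, ‖dilate φ s x‖ = ∫ x, ‖φ x‖ := by
  unfold dilate
  simp_rw [norm_smul, norm_inv, norm_pow, Real.norm_of_nonneg hs.le]
  rw [integral_const_mul, Measure.integral_comp_inv_smul volume (fun x => ‖φ x‖),
    finrank_euclideanSpace, Fintype.card_fin, abs_of_pos (by positivity), smul_eq_mul,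
    inv_mul_cancel_left₀ (by positivity)]

theorem IsMaximalKernel.integrable_dilate (hφ : IsMaximalKernel φ) {s : ℝ} (hs : 0 < s) :
    Integrable (dilate φ s) :=
  (hφ.continuous_dilate s).integrable_of_hasCompactSupport (hφ.hasCompactSupport_dilate hs)

/-- Convolving the cutoff with a kernel of much smaller scale reproduces `∫ φ` times the cutoff, up
to an error proportional to the ratio of the scales. -/
theorem IsMaximalKernel.norm_integral_ramp_mul_dilate_sub_le (hφ : IsMaximalKernel φ)
    (x₀ y : EuclideanSpace ℝ (Fin n)) {s t : ℝ} (hs : 0 < s) (ht : 0 < t) (hst : s ≤ t) :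
    ‖(∫ x, (ramp x₀ t x : 𝕜) * dilate φ s (x - y)) - (ramp x₀ t y : 𝕜) * ∫ x, φ x‖
      ≤ (Metric.closedBall x₀ (3 * t)).indicator (fun _ => s / t * ∫ x, ‖φ x‖) y := by
  have hint : Integrable fun x => dilate φ s (x - y) := (hφ.integrable_dilate hs).comp_sub_right y
  by_cases hy : y ∈ Metric.closedBall x₀ (3 * t)
  · rw [Set.indicator_of_mem hy, ← integral_dilate φ hs,
      ← integral_sub_right_eq_self (dilate φ s) y, ← integral_const_mul, ← integral_sub]
    · refine (norm_integral_le_integral_norm _).trans ?_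
      rw [← integral_norm_dilate φ hs, ← integral_sub_right_eq_self (fun x => ‖dilate φ s x‖) y,
        ← integral_const_mul]
      refine integral_mono_of_nonneg (Filter.Eventually.of_forall fun x => norm_nonneg _)
        (hint.norm.const_mul _) (Filter.Eventually.of_forall fun x => ?_)
      simp only
      rw [← sub_mul, norm_mul, ← RCLike.ofReal_sub, RCLike.norm_ofReal]
      rcases le_or_gt s ‖x - y‖ with h | h
      · rw [hφ.dilate_eq_zero hs h]; simp
      · refine mul_le_mul_of_nonneg_right ((abs_ramp_sub_le ht x y).trans ?_) (norm_nonneg _)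
        gcongr
    · refine hint.bdd_mul (c := 1)
        (RCLike.continuous_ofReal.comp (continuous_ramp x₀ t)).aestronglyMeasurable
        (Filter.Eventually.of_forall fun x => ?_)
      rw [RCLike.norm_ofReal, abs_of_nonneg (ramp_nonneg _ _ _)]
      exact ramp_le_one _ _ _
    · exact hint.const_mul _
  · rw [Metric.mem_closedBall, not_le, dist_eq_norm] at hy
    rw [ramp_eq_zero ht (by linarith), RCLike.ofReal_zero, zero_mul, sub_zero,
      integral_eq_zero_of_ae, norm_zero]
    · exact Set.indicator_nonneg (fun _ _ => by positivity) _
    · refine Filter.Eventually.of_forall fun x => ?_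
      simp only [Pi.zero_apply, mul_eq_zero]
      rcases le_or_gt s ‖x - y‖ with h | h
      · exact Or.inr (hφ.dilate_eq_zero hs h)
      · left
        have : ‖y - x₀‖ ≤ ‖x - y‖ + ‖x - x₀‖ := by
          rw [norm_sub_rev x y]
          exact norm_sub_le_norm_sub_add_norm_sub _ _ _
        rw [ramp_eq_zero ht (by linarith), RCLike.ofReal_zero]

theorem IsMaximalKernel.integrable_prod_mul_dilate_mul (hφ : IsMaximalKernel φ)
    (hf : Integrable f) {s : ℝ} (hs : 0 < s) {η : EuclideanSpace ℝ (Fin n) → 𝕜}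
    (hη : AEStronglyMeasurable η) (hη1 : ∀ x, ‖η x‖ ≤ 1) :
    Integrable (fun p : EuclideanSpace ℝ (Fin n) × EuclideanSpace ℝ (Fin n) =>
      η p.1 * (dilate φ s (p.1 - p.2) * f p.2)) (volume.prod volume) := by
  have h1 : Integrable (fun p : EuclideanSpace ℝ (Fin n) × EuclideanSpace ℝ (Fin n) =>
      f p.2 * dilate φ s (p.1 - p.2)) (volume.prod volume) :=
    Integrable.convolution_integrand (ContinuousLinearMap.mul 𝕜 𝕜) hf (hφ.integrable_dilate hs)
  refine Integrable.bdd_mul (c := 1) ?_ hη.comp_fst (Filter.Eventually.of_forall fun p => hη1 p.1)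
  simpa only [mul_comm] using h1

theorem IsMaximalKernel.integrable_integral_mul_dilate_mul (hφ : IsMaximalKernel φ)
    (hf : Integrable f) {s : ℝ} (hs : 0 < s) {η : EuclideanSpace ℝ (Fin n) → 𝕜}
    (hη : AEStronglyMeasurable η) (hη1 : ∀ x, ‖η x‖ ≤ 1) :
    Integrable fun y => (∫ x, η x * dilate φ s (x - y)) * f y := by
  refine (hφ.integrable_prod_mul_dilate_mul hf hs hη hη1).integral_prod_right.congr
    (Filter.Eventually.of_forall fun y => ?_)
  simp only
  rw [← integral_mul_const]
  simp_rw [mul_assoc]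

theorem IsMaximalKernel.integral_mul_convolution_eq (hφ : IsMaximalKernel φ) (hf : Integrable f)
    {s : ℝ} (hs : 0 < s) {η : EuclideanSpace ℝ (Fin n) → 𝕜} (hη : AEStronglyMeasurable η)
    (hη1 : ∀ x, ‖η x‖ ≤ 1) :
    ∫ x, η x * ∫ y, dilate φ s (x - y) * f y = ∫ y, (∫ x, η x * dilate φ s (x - y)) * f y := by
  simp_rw [← integral_const_mul]
  rw [integral_integral_swap (hφ.integrable_prod_mul_dilate_mul hf hs hη hη1)]
  refine integral_congr_ae (Filter.Eventually.of_forall fun y => ?_)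
  simp only
  rw [← integral_mul_const]
  simp_rw [mul_assoc]

/-- Tested against the cutoff, the convolution of a nonnegative `h` with a kernel of small scale is
at least `∫ φ` times the mass of `h`, whatever the sign of the kernel. -/
theorem IsMaximalKernel.le_norm_integral_ramp_mul_convolution (hφ : IsMaximalKernel φ)
    {h : EuclideanSpace ℝ (Fin n) → ℝ} (hh : Integrable h) (h0 : ∀ y, 0 ≤ h y)
    (x₀ : EuclideanSpace ℝ (Fin n)) {s t : ℝ} (hs : 0 < s) (ht : 0 < t) (hst : s ≤ t) :
    ‖∫ x, φ x‖ * (∫ y in Metric.closedBall x₀ t, h y)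
        - s / t * (∫ x, ‖φ x‖) * (∫ y in Metric.closedBall x₀ (3 * t), h y)
      ≤ ‖∫ x, (ramp x₀ t x : 𝕜) * ∫ y, dilate φ s (x - y) * (h y : 𝕜)‖ := by
  have hη : Continuous fun x => (ramp x₀ t x : 𝕜) :=
    RCLike.continuous_ofReal.comp (continuous_ramp x₀ t)
  have hη1 : ∀ x, ‖(ramp x₀ t x : 𝕜)‖ ≤ 1 := fun x => by
    rw [RCLike.norm_ofReal, abs_of_nonneg (ramp_nonneg _ _ _)]
    exact ramp_le_one _ _ _
  rw [hφ.integral_mul_convolution_eq hh.ofReal hs hη.aestronglyMeasurable hη1]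
  have hηh : Integrable fun y => ramp x₀ t y * h y := by
    refine hh.bdd_mul (c := 1) (continuous_ramp x₀ t).aestronglyMeasurable
      (Filter.Eventually.of_forall fun x => ?_)
    rw [Real.norm_of_nonneg (ramp_nonneg _ _ _)]
    exact ramp_le_one _ _ _
  set G : EuclideanSpace ℝ (Fin n) → 𝕜 := fun y => ∫ x, (ramp x₀ t x : 𝕜) * dilate φ s (x - y)
    with hG
  -- the main term
  have hmain : (∫ y in Metric.closedBall x₀ t, h y) ≤ ∫ y, ramp x₀ t y * h y := by
    rw [← integral_indicator Metric.isClosed_closedBall.measurableSet]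
    refine integral_mono (hh.indicator Metric.isClosed_closedBall.measurableSet) hηh fun y => ?_
    by_cases hy : y ∈ Metric.closedBall x₀ t
    · rw [Set.indicator_of_mem hy, ramp_eq_one ht (by rwa [← dist_eq_norm]), one_mul]
    · rw [Set.indicator_of_notMem hy]
      exact mul_nonneg (ramp_nonneg _ _ _) (h0 y)
  -- the error term
  have hdom : Integrable fun y => (Metric.closedBall x₀ (3 * t)).indicator h y
      * (s / t * ∫ x, ‖φ x‖) :=
    (hh.indicator Metric.isClosed_closedBall.measurableSet).mul_const _
  have hpt : ∀ y, ‖(G y - (ramp x₀ t y : 𝕜) * ∫ x, φ x) * (h y : 𝕜)‖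
      ≤ (Metric.closedBall x₀ (3 * t)).indicator h y * (s / t * ∫ x, ‖φ x‖) := by
    intro y
    rw [norm_mul, RCLike.norm_ofReal, abs_of_nonneg (h0 y)]
    refine (mul_le_mul_of_nonneg_right
      (hφ.norm_integral_ramp_mul_dilate_sub_le x₀ y hs ht hst) (h0 y)).trans (le_of_eq ?_)
    by_cases hy : y ∈ Metric.closedBall x₀ (3 * t)
    · rw [Set.indicator_of_mem hy, Set.indicator_of_mem hy, mul_comm]
    · rw [Set.indicator_of_notMem hy, Set.indicator_of_notMem hy, zero_mul, zero_mul]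
  have hE : Integrable fun y => (G y - (ramp x₀ t y : 𝕜) * ∫ x, φ x) * (h y : 𝕜) := by
    refine ((hφ.integrable_integral_mul_dilate_mul hh.ofReal hs hη.aestronglyMeasurable hη1).sub
      (hηh.ofReal.const_mul (∫ x, φ x))).congr (Filter.Eventually.of_forall fun y => ?_)
    simp only [hG, Pi.sub_apply, RCLike.ofReal_mul]
    ring
  have hsplit : ∫ y, G y * (h y : 𝕜) = (∫ x, φ x) * ((∫ y, ramp x₀ t y * h y : ℝ) : 𝕜)
      + ∫ y, (G y - (ramp x₀ t y : 𝕜) * ∫ x, φ x) * (h y : 𝕜) := by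
    rw [← integral_ofReal, ← integral_const_mul, ← integral_add (hηh.ofReal.const_mul _) hE]
    refine integral_congr_ae (Filter.Eventually.of_forall fun y => ?_)
    simp only [RCLike.ofReal_mul]
    ring
  have herr : ‖∫ y, (G y - (ramp x₀ t y : 𝕜) * ∫ x, φ x) * (h y : 𝕜)‖
      ≤ s / t * (∫ x, ‖φ x‖) * (∫ y in Metric.closedBall x₀ (3 * t), h y) := by
    refine (norm_integral_le_of_norm_le hdom (Filter.Eventually.of_forall hpt)).trans
      (le_of_eq ?_)
    rw [integral_mul_const, integral_indicator Metric.isClosed_closedBall.measurableSet, mul_comm]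
  rw [hsplit]
  have h1 := norm_sub_le_norm_add ((∫ x, φ x) * ((∫ y, ramp x₀ t y * h y : ℝ) : 𝕜))
    (∫ y, (G y - (ramp x₀ t y : 𝕜) * ∫ x, φ x) * (h y : 𝕜))
  rw [norm_mul, RCLike.norm_ofReal] at h1
  have h2 : ‖∫ x, φ x‖ * (∫ y in Metric.closedBall x₀ t, h y)
      ≤ ‖∫ x, φ x‖ * |∫ y, ramp x₀ t y * h y| := by
    gcongr
    exact hmain.trans (le_abs_self _)
  linarith

end LowerBound

/-! ### The reverse weak-type inequality and necessity of `L log L` -/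

section LowerBoundLevel

variable {𝕜 : Type*} [RCLike 𝕜] {n : ℕ} {φ f : EuclideanSpace ℝ (Fin n) → 𝕜}

theorem IsMaximalKernel.norm_integral_dilate_mul_le (hφ : IsMaximalKernel φ) {C : ℝ} (hC0 : 0 < C)
    (hC : ∀ x, ‖φ x‖ ≤ C) {h : EuclideanSpace ℝ (Fin n) → ℝ} (hh : Integrable h)
    (h0 : ∀ y, 0 ≤ h y) {s : ℝ} (hs : 0 < s) (x : EuclideanSpace ℝ (Fin n)) :
    ‖∫ y, dilate φ s (x - y) * (h y : 𝕜)‖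
      ≤ C * ((s ^ n)⁻¹ * ∫ y in Metric.closedBall x s, h y) := by
  have h1 := hφ.enorm_integral_dilate_mul_le hC hs (fun y => (h y : 𝕜)) x
  have h2 : ∀ y, ‖(h y : 𝕜)‖ₑ = ENNReal.ofReal (h y) := fun y => by
    rw [← ofReal_norm, RCLike.norm_ofReal, abs_of_nonneg (h0 y)]
  have h3 : 0 ≤ ∫ y in Metric.closedBall x s, h y := integral_nonneg h0
  simp_rw [h2] at h1
  rw [← ofReal_integral_eq_lintegral_ofReal hh.integrableOn (Filter.Eventually.of_forall h0),
    ← ENNReal.ofReal_mul (by positivity), ← ENNReal.ofReal_mul hC0.le, ← ofReal_norm] at h1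
  exact (ENNReal.ofReal_le_ofReal_iff (by positivity)).1 h1

/-- Suppose that the nonnegative function `h` has mass of order `l * t ^ n` in the ball of radius
`t` about `x₀` and that its mass in the ball of radius `3 t` is not of larger order. Then `M_φ h`
is at least of order `l` on a fixed proportion of the ball of radius `2 t`. -/
theorem IsMaximalKernel.exists_le_volume_lt_maximalFunction (hφ : IsMaximalKernel φ) {κ₀ κ₁ : ℝ}
    (hκ₀ : 0 < κ₀) (hκ₁ : 0 < κ₁) :
    ∃ c δ : ℝ, 0 < c ∧ 0 < δ ∧ ∀ h : EuclideanSpace ℝ (Fin n) → ℝ, Integrable h → (∀ y, 0 ≤ h y) →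
      ∀ (x₀ : EuclideanSpace ℝ (Fin n)) (t l : ℝ), 0 < t → 0 < l →
        κ₀ * l * t ^ n ≤ ∫ y in Metric.closedBall x₀ t, h y →
        ∫ y in Metric.closedBall x₀ (3 * t), h y ≤ κ₁ * l * t ^ n →
        ENNReal.ofReal (δ * t ^ n) ≤ volume (Metric.closedBall x₀ (2 * t) ∩
          {x | ENNReal.ofReal (c * l) < maximalFunction φ (fun y => (h y : 𝕜)) x}) := by
  obtain ⟨C, hC0, hC, -⟩ := hφ.exists_bound
  set V := (volume (Metric.ball (0 : EuclideanSpace ℝ (Fin n)) 1)).toReal with hV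
  have hVtop : volume (Metric.ball (0 : EuclideanSpace ℝ (Fin n)) 1) ≠ ∞ := measure_ball_lt_top.ne
  have hVpos : 0 < V := ENNReal.toReal_pos (Metric.measure_ball_pos _ _ one_pos).ne' hVtop
  set a := ‖∫ x, φ x‖ with ha
  have hapos : 0 < a := norm_pos_iff.2 hφ.2.2
  set N := ∫ x, ‖φ x‖ with hN
  have hNpos : 0 < N := hapos.trans_le (norm_integral_le_integral_norm _)
  -- the scale of the kernel, relative to that of the ball, at which the error is half the main term
  set τ := min 1 (a * κ₀ / (2 * N * κ₁)) with hτ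
  have hτpos : 0 < τ := lt_min one_pos (by positivity)
  have hτ1 : τ ≤ 1 := min_le_left _ _
  have hτ2 : τ * N * κ₁ ≤ a * κ₀ / 2 := by
    have : τ ≤ a * κ₀ / (2 * N * κ₁) := min_le_right _ _
    rw [le_div_iff₀ (by positivity)] at this
    linarith
  set K := C * ((τ ^ n)⁻¹ * κ₁) with hK
  have hKpos : 0 < K := by positivity
  set c := a * κ₀ / (4 * (2 ^ n * V)) with hc
  have hcpos : 0 < c := by positivity
  refine ⟨c, a * κ₀ / (4 * K), hcpos, by positivity, ?_⟩
  intro h hh h0 x₀ t l ht hl hlow hup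
  set s := τ * t with hs
  have hspos : 0 < s := by positivity
  have hst : s ≤ t := mul_le_of_le_one_left ht.le hτ1
  set u : EuclideanSpace ℝ (Fin n) → 𝕜 := fun x => ∫ y, dilate φ s (x - y) * (h y : 𝕜) with hu
  have huc : Continuous u := by
    have : u = convolution (dilate φ s) (fun y => (h y : 𝕜)) (ContinuousLinearMap.mul 𝕜 𝕜) volume :=
      funext fun x => (convolution_dilate_eq φ _ s x).symm
    rw [this]
    exact (hφ.hasCompactSupport_dilate hspos).continuous_convolution_left _
      (hφ.continuous_dilate s) hh.ofReal.locallyIntegrable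
  set B := Metric.closedBall x₀ (2 * t) with hB
  have hBm : MeasurableSet B := Metric.isClosed_closedBall.measurableSet
  set G := B ∩ {x | c * l < ‖u x‖} with hG
  have hGm : MeasurableSet G := hBm.inter (measurableSet_lt measurable_const huc.norm.measurable)
  have hGsub : G ⊆ B ∩ {x | ENNReal.ofReal (c * l) < maximalFunction φ (fun y => (h y : 𝕜)) x} := by
    rintro x ⟨hx, hx'⟩
    refine ⟨hx, lt_of_lt_of_le ?_ (enorm_convolution_dilate_le_maximalFunction φ _ hspos x)⟩
    rw [← ofReal_norm]
    exact (ENNReal.ofReal_lt_ofReal_iff_of_nonneg (by positivity)).2 hx'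
  refine le_trans ?_ (measure_mono hGsub)
  have hGfin : volume G ≠ ∞ :=
    ne_top_of_le_ne_top measure_closedBall_lt_top.ne (measure_mono Set.inter_subset_left)
  have hBvol : volume.real B = (2 * t) ^ n * V := by
    rw [measureReal_def, hB, volume_closedBall_eq x₀ (by positivity), ENNReal.toReal_mul,
      ENNReal.toReal_ofReal (by positivity)]
  -- the lower bound for the tested convolution
  have hJlow : a * κ₀ / 2 * (l * t ^ n) ≤ ‖∫ x, (ramp x₀ t x : 𝕜) * u x‖ := by
    refine le_trans ?_ (hφ.le_norm_integral_ramp_mul_convolution hh h0 x₀ hspos ht hst)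
    have h1 : a * (κ₀ * l * t ^ n) ≤ a * ∫ y in Metric.closedBall x₀ t, h y := by gcongr
    have h2 : s / t * N * (∫ y in Metric.closedBall x₀ (3 * t), h y)
        ≤ a * κ₀ / 2 * (l * t ^ n) := by
      have : s / t = τ := by rw [hs]; field_simp
      rw [this]
      calc τ * N * (∫ y in Metric.closedBall x₀ (3 * t), h y) ≤ τ * N * (κ₁ * l * t ^ n) := by gcongr
        _ = τ * N * κ₁ * (l * t ^ n) := by ring
        _ ≤ _ := by gcongr
    linarith
  -- the pointwise bound on the ball
  have hub : ∀ x ∈ B, ‖u x‖ ≤ K * l := by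
    intro x hx
    refine (hφ.norm_integral_dilate_mul_le hC0 hC hh h0 hspos x).trans ?_
    have h1 : ∫ y in Metric.closedBall x s, h y ≤ ∫ y in Metric.closedBall x₀ (3 * t), h y := by
      refine setIntegral_mono_set hh.integrableOn (Filter.Eventually.of_forall h0)
        (LE.le.eventuallyLE (Metric.closedBall_subset_closedBall' ?_))
      have := Metric.mem_closedBall.1 hx
      linarith
    calc C * ((s ^ n)⁻¹ * ∫ y in Metric.closedBall x s, h y)
        ≤ C * ((s ^ n)⁻¹ * (κ₁ * l * t ^ n)) := by gcongr; exact h1.trans hup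
      _ = K * l := by rw [hs, hK, mul_pow]; field_simp
  have hJup : ‖∫ x, (ramp x₀ t x : 𝕜) * u x‖ ≤ c * l * volume.real B + K * l * volume.real G := by
    have hi1 : Integrable (B.indicator fun _ => c * l) :=
      (integrable_indicator_iff hBm).2 (integrableOn_const measure_closedBall_lt_top.ne)
    have hi2 : Integrable (G.indicator fun _ => K * l) :=
      (integrable_indicator_iff hGm).2 (integrableOn_const hGfin)
    refine (norm_integral_le_of_norm_le (hi1.add hi2) (Filter.Eventually.of_forall
      fun x => ?_)).trans (le_of_eq ?_)
    · rw [norm_mul, RCLike.norm_ofReal, abs_of_nonneg (ramp_nonneg _ _ _), Pi.add_apply]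
      by_cases hx : x ∈ B
      · rw [Set.indicator_of_mem hx]
        have h1 : ramp x₀ t x * ‖u x‖ ≤ ‖u x‖ :=
          mul_le_of_le_one_left (norm_nonneg _) (ramp_le_one _ _ _)
        by_cases hxG : x ∈ G
        · rw [Set.indicator_of_mem hxG]
          have := hub x hx
          have : 0 ≤ c * l := by positivity
          linarith
        · rw [Set.indicator_of_notMem hxG]
          have : ‖u x‖ ≤ c * l := by
            by_contra! hlt
            exact hxG ⟨hx, hlt⟩
          linarith
      · have hxG : x ∉ G := fun hxG => hx hxG.1
        rw [Set.indicator_of_notMem hx, Set.indicator_of_notMem hxG, ramp_eq_zero ht]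
        · simp
        · rw [hB, Metric.mem_closedBall, not_le, dist_eq_norm] at hx
          exact hx.le
    · rw [integral_add' hi1 hi2, integral_indicator_const _ hBm, integral_indicator_const _ hGm,
        smul_eq_mul, smul_eq_mul]
      ring
  rw [← ENNReal.ofReal_toReal hGfin]
  refine ENNReal.ofReal_le_ofReal ?_
  rw [← measureReal_def]
  have h1 : c * l * volume.real B = a * κ₀ / 4 * (l * t ^ n) := by
    rw [hBvol, hc, mul_pow]; field_simp
  have h2 : a * κ₀ / 4 * (l * t ^ n) ≤ K * l * volume.real G := by
    have := hJlow.trans hJup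
    linarith
  have h3 : a * κ₀ / 4 * t ^ n ≤ K * volume.real G := by
    refine le_of_mul_le_mul_left ?_ hl
    linarith
  calc a * κ₀ / (4 * K) * t ^ n = (a * κ₀ / 4 * t ^ n) / K := by field_simp
    _ ≤ volume.real G := by
      rw [div_le_iff₀ hKpos]
      linarith

/-- At almost every point where an integrable `h ≥ 0` exceeds `l` there is a ball in which the
average exceeds `l`, whereas the averages over its dyadic dilates do not. -/
theorem ae_exists_stopping_radius (hn : 1 ≤ n) {h : EuclideanSpace ℝ (Fin n) → ℝ}
    (hh : Integrable h) (h0 : ∀ y, 0 ≤ h y) {V : ℝ}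
    (hV : V = (volume (Metric.ball (0 : EuclideanSpace ℝ (Fin n)) 1)).toReal) :
    ∀ᵐ x, ∀ l : ℝ, 0 < l → l < h x → ∃ t : ℝ, 0 < t ∧
      V * l * t ^ n ≤ ∫ y in Metric.closedBall x t, h y ∧
      ∀ j : ℕ, 1 ≤ j → ∫ y in Metric.closedBall x (2 ^ j * t), h y ≤ V * l * (2 ^ j * t) ^ n := by
  have hVpos : 0 < V := by
    rw [hV]
    exact ENNReal.toReal_pos (Metric.measure_ball_pos _ _ one_pos).ne' measure_ball_lt_top.ne
  filter_upwards [IsUnifLocDoublingMeasure.ae_tendsto_average volume hh.locallyIntegrable 1]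
    with x hx l hl hlx
  have hlim := hx (l := nhdsWithin (0 : ℝ) (Set.Ioi 0)) (fun _ => x) id Filter.tendsto_id (by
    filter_upwards [self_mem_nhdsWithin] with r hr
    have hr' : (0 : ℝ) < r := hr
    exact Metric.mem_closedBall_self (by simpa using hr'.le))
  obtain ⟨r, hrl, hr⟩ := ((hlim.eventually (lt_mem_nhds hlx)).and self_mem_nhdsWithin).exists
  have hr0 : (0 : ℝ) < r := hr
  have hlow : V * l * r ^ n < ∫ y in Metric.closedBall x r, h y := by
    have hvol : volume.real (Metric.closedBall x r) = r ^ n * V := by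
      rw [measureReal_def, volume_closedBall_eq x hr0.le, ENNReal.toReal_mul,
        ENNReal.toReal_ofReal (by positivity), hV]
    rw [id, setAverage_eq, hvol, smul_eq_mul, ← div_eq_inv_mul, lt_div_iff₀ (by positivity)] at hrl
    linarith
  set P : ℕ → Prop := fun m => V * l * (2 ^ m * r) ^ n < ∫ y in Metric.closedBall x (2 ^ m * r), h y
    with hP
  -- the masses being bounded by `∫ h`, only finitely many dyadic dilates have large average
  obtain ⟨M, hM⟩ := pow_unbounded_of_one_lt (max 1 ((∫ y, h y) / (V * l)) / r)
    (one_lt_two : (1 : ℝ) < 2)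
  have hbound : ∀ m, P m → m ≤ M := by
    intro m hm
    by_contra! hlt
    have h1 : (∫ y in Metric.closedBall x (2 ^ m * r), h y) ≤ ∫ y, h y :=
      setIntegral_le_integral hh (Filter.Eventually.of_forall h0)
    have h2 : max 1 ((∫ y, h y) / (V * l)) < 2 ^ m * r := by
      rw [div_lt_iff₀ hr0] at hM
      refine hM.trans_le ?_
      gcongr
      exact one_le_two
    have h3 : 2 ^ m * r ≤ (2 ^ m * r) ^ n :=
      le_self_pow₀ ((le_max_left _ _).trans h2.le) (by omega)
    have h4 : (∫ y, h y) / (V * l) < (2 ^ m * r) ^ n :=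
      ((le_max_right _ _).trans_lt h2).trans_le h3
    rw [div_lt_iff₀ (by positivity)] at h4
    have h5 : V * l * (2 ^ m * r) ^ n < ∫ y in Metric.closedBall x (2 ^ m * r), h y := hm
    linarith
  have hP0 : P 0 := by simpa [hP] using hlow
  classical
  have hspec : P (Nat.findGreatest P M) := Nat.findGreatest_spec (Nat.zero_le M) hP0
  set m := Nat.findGreatest P M
  refine ⟨2 ^ m * r, by positivity, hspec.le, fun j hj => ?_⟩
  by_contra! hlt
  have hPj : P (m + j) := by
    simp only [hP, pow_add, mul_comm (2 ^ m) (2 ^ j : ℝ), mul_assoc]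
    simpa only [mul_assoc] using hlt
  have := Nat.le_findGreatest (hbound _ hPj) hPj
  omega

theorem maximalFunction_le_add {g k : EuclideanSpace ℝ (Fin n) → 𝕜} (hφ : IsMaximalKernel φ)
    (hf : Integrable f) (hk : Integrable k) (hg : ∀ y, g y = f y + k y)
    (x : EuclideanSpace ℝ (Fin n)) :
    maximalFunction φ g x ≤ maximalFunction φ f x + maximalFunction φ k x := by
  refine maximalFunction_le_of_forall fun t ht => ?_
  simp_rw [hg, mul_add]
  rw [integral_add (hφ.integrable_dilate_mul hf ht x) (hφ.integrable_dilate_mul hk ht x)]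
  exact (enorm_add_le _ _).trans (add_le_add
    (enorm_convolution_dilate_le_maximalFunction φ f ht x)
    (enorm_convolution_dilate_le_maximalFunction φ k ht x))

theorem IsMaximalKernel.exists_maximalFunction_le_of_bounded (hφ : IsMaximalKernel φ)
    {k : EuclideanSpace ℝ (Fin n) → 𝕜} {B : ℝ} (hB : 0 ≤ B) (hk : ∀ y, ‖k y‖ ≤ B) :
    ∃ D : ℝ, 0 ≤ D ∧ ∀ x, maximalFunction φ k x ≤ ENNReal.ofReal D := by
  have hN : 0 ≤ ∫ x, ‖φ x‖ := integral_nonneg fun _ => norm_nonneg _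
  refine ⟨(∫ x, ‖φ x‖) * B, by positivity, fun x => maximalFunction_le_of_forall fun t ht => ?_⟩
  have hint : Integrable fun y => ‖dilate φ t (x - y)‖ * B :=
    (((hφ.integrable_dilate ht).comp_sub_left x).norm).mul_const B
  rw [← ofReal_norm]
  refine ENNReal.ofReal_le_ofReal ((norm_integral_le_of_norm_le hint
    (Filter.Eventually.of_forall fun y => ?_)).trans (le_of_eq ?_))
  · rw [norm_mul]
    gcongr
    exact hk y
  · rw [integral_mul_const, integral_sub_left_eq_self (fun y => ‖dilate φ t y‖),
      integral_norm_dilate φ ht]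

/-- The reverse weak-type inequality: above a certain level, the mass of `h` where `h > l` is
controlled by the level sets of `M_φ f`, where `f` differs from `h` by a bounded function. -/
theorem IsMaximalKernel.exists_setLIntegral_le_volume (hn : 1 ≤ n) (hφ : IsMaximalKernel φ)
    {h k : EuclideanSpace ℝ (Fin n) → ℝ} (hh : Integrable h) (h0 : ∀ y, 0 ≤ h y)
    (hk : Integrable k) {B : ℝ} (hB : 0 ≤ B) (hkB : ∀ y, |k y| ≤ B) :
    ∃ (c l₀ : ℝ) (K : ℝ≥0∞), 0 < c ∧ 0 < l₀ ∧ K ≠ ∞ ∧ ∀ l, l₀ ≤ l →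
      ∫⁻ y, ENNReal.ofReal (h y) * (if l < h y then 1 else 0)
        ≤ K * (ENNReal.ofReal l * volume {x | ENNReal.ofReal (c * l)
            < maximalFunction φ (fun y => ((h y - k y : ℝ) : 𝕜)) x}) := by
  set V := (volume (Metric.ball (0 : EuclideanSpace ℝ (Fin n)) 1)).toReal with hV
  have hVpos : 0 < V :=
    ENNReal.toReal_pos (Metric.measure_ball_pos _ _ one_pos).ne' measure_ball_lt_top.ne
  obtain ⟨c, δ, hc, hδ, hlow⟩ := hφ.exists_le_volume_lt_maximalFunction hVpos
    (κ₁ := V * 4 ^ n) (by positivity)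
  obtain ⟨D, hD, hkD⟩ := hφ.exists_maximalFunction_le_of_bounded (k := fun y => (k y : 𝕜)) hB
    (fun y => by rw [RCLike.norm_ofReal]; exact hkB y)
  refine ⟨c / 2, max 1 (2 * D / c), ENNReal.ofReal (V * 16 ^ n / δ), by positivity, by positivity,
    ENNReal.ofReal_ne_top, fun l hl => ?_⟩
  have hl0 : 0 < l := zero_lt_one.trans_le ((le_max_left _ _).trans hl)
  have hlD : D ≤ c / 2 * l := by
    have := (le_max_right 1 (2 * D / c)).trans hl
    rw [div_le_iff₀ hc] at this
    linarith
  set F : EuclideanSpace ℝ (Fin n) → 𝕜 := fun y => ((h y - k y : ℝ) : 𝕜) with hF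
  have hFi : Integrable F := (hh.sub hk).ofReal
  set Y := {x | ENNReal.ofReal (c / 2 * l) < maximalFunction φ F x} with hY
  have hYm : MeasurableSet Y := measurableSet_lt measurable_const (hφ.measurable_maximalFunction hFi)
  have hsubY : {x | ENNReal.ofReal (c * l) < maximalFunction φ (fun y => (h y : 𝕜)) x} ⊆ Y := by
    intro x hx
    by_contra hxY
    refine absurd (show ENNReal.ofReal (c * l) < _ from hx) (not_lt.2 ?_)
    have h1 := maximalFunction_le_add (g := fun y => (h y : 𝕜)) hφ hFi hk.ofReal
      (fun y => by simp [hF]) x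
    refine h1.trans ((add_le_add (not_lt.1 hxY) ((hkD x).trans
      (ENNReal.ofReal_le_ofReal hlD))).trans (le_of_eq ?_))
    rw [← ENNReal.ofReal_add (by positivity) (by positivity)]
    congr 1; ring
  -- the stopping radii
  set S := {x | ∃ t : ℝ, 0 < t ∧ V * l * t ^ n ≤ ∫ y in Metric.closedBall x t, h y ∧
      ∀ j : ℕ, 1 ≤ j → ∫ y in Metric.closedBall x (2 ^ j * t), h y ≤ V * l * (2 ^ j * t) ^ n}
    with hS
  have hex : ∀ x, ∃ t : ℝ, x ∈ S → 0 < t ∧ V * l * t ^ n ≤ ∫ y in Metric.closedBall x t, h y ∧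
      ∀ j : ℕ, 1 ≤ j → ∫ y in Metric.closedBall x (2 ^ j * t), h y ≤ V * l * (2 ^ j * t) ^ n := by
    intro x
    by_cases hx : x ∈ S
    · obtain ⟨t, ht⟩ := hx
      exact ⟨t, fun _ => ht⟩
    · exact ⟨0, fun h => absurd h hx⟩
  choose r hr using hex
  have hbound : ∀ x ∈ S, 2 * r x ≤ 2 * max 1 ((∫ y, h y) / (V * l)) := by
    intro x hx
    obtain ⟨hr0, hr1, -⟩ := hr x hx
    by_contra! hlt
    obtain ⟨hlt1, hlt2⟩ := max_lt_iff.1 (lt_of_mul_lt_mul_left hlt zero_le_two)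
    have h1 : (∫ y in Metric.closedBall x (r x), h y) ≤ ∫ y, h y :=
      setIntegral_le_integral hh (Filter.Eventually.of_forall h0)
    have h2 : r x ≤ r x ^ n := le_self_pow₀ hlt1.le (by omega)
    rw [div_lt_iff₀ (by positivity)] at hlt2
    have h3 : r x * (V * l) ≤ r x ^ n * (V * l) := by gcongr
    linarith
  obtain ⟨T, hTS, hTc, hdisj, hcov⟩ := exists_countable_disjoint_closedBall_cover S
    (fun x => 2 * r x) _ (fun x hx => mul_pos two_pos (hr x hx).1) hbound
  have hTcount : Countable T := hTc.to_subtype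
  -- mass of the enlarged balls, and their share of the level set of the maximal function
  have hone : ∀ x ∈ T, ∫⁻ y in Metric.closedBall x (5 * (2 * r x)), ENNReal.ofReal (h y)
      ≤ ENNReal.ofReal (V * 16 ^ n / δ) * (ENNReal.ofReal l
        * ∫⁻ y in Metric.closedBall x (2 * r x), Y.indicator 1 y) := by
    intro x hx
    obtain ⟨hr0, hr1, hr2⟩ := hr x (hTS hx)
    have hmass3 : ∫ y in Metric.closedBall x (3 * r x), h y ≤ V * 4 ^ n * l * r x ^ n := by
      calc ∫ y in Metric.closedBall x (3 * r x), h y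
          ≤ ∫ y in Metric.closedBall x (2 ^ 2 * r x), h y :=
            setIntegral_mono_set hh.integrableOn (Filter.Eventually.of_forall h0)
              (LE.le.eventuallyLE (Metric.closedBall_subset_closedBall (by linarith)))
        _ ≤ V * l * (2 ^ 2 * r x) ^ n := hr2 2 (by norm_num)
        _ = _ := by rw [mul_pow]; norm_num; ring
    have hshare := hlow h hh h0 x (r x) l hr0 hl0 hr1 hmass3
    calc ∫⁻ y in Metric.closedBall x (5 * (2 * r x)), ENNReal.ofReal (h y)
        ≤ ∫⁻ y in Metric.closedBall x (2 ^ 4 * r x), ENNReal.ofReal (h y) :=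
          lintegral_mono_set (Metric.closedBall_subset_closedBall (by linarith))
      _ = ENNReal.ofReal (∫ y in Metric.closedBall x (2 ^ 4 * r x), h y) :=
          (ofReal_integral_eq_lintegral_ofReal hh.integrableOn
            (Filter.Eventually.of_forall h0)).symm
      _ ≤ ENNReal.ofReal (V * l * (2 ^ 4 * r x) ^ n) :=
          ENNReal.ofReal_le_ofReal (hr2 4 (by norm_num))
      _ = ENNReal.ofReal (V * 16 ^ n / δ) * (ENNReal.ofReal l * ENNReal.ofReal (δ * r x ^ n)) := by
          rw [← ENNReal.ofReal_mul hl0.le, ← ENNReal.ofReal_mul (by positivity)]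
          congr 1
          rw [mul_pow]
          norm_num
          field_simp
      _ ≤ _ := by
          gcongr
          rw [lintegral_indicator_one hYm, Measure.restrict_apply hYm, Set.inter_comm]
          exact hshare.trans (measure_mono (Set.inter_subset_inter_right _ hsubY))
  have hSae : ∀ᵐ y, l < h y → y ∈ S := by
    filter_upwards [ae_exists_stopping_radius hn hh h0 hV] with y hy hly
    exact hy l hl0 hly
  calc ∫⁻ y, ENNReal.ofReal (h y) * (if l < h y then 1 else 0)
      ≤ ∫⁻ y, (⋃ x ∈ T, Metric.closedBall x (5 * (2 * r x))).indicator
          (fun y => ENNReal.ofReal (h y)) y := by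
        refine lintegral_mono_ae ?_
        filter_upwards [hSae] with y hy
        split_ifs with hly
        · rw [Set.indicator_of_mem (hcov (hy hly)), mul_one]
        · rw [mul_zero]; exact zero_le
    _ = ∫⁻ y in ⋃ x ∈ T, Metric.closedBall x (5 * (2 * r x)), ENNReal.ofReal (h y) :=
        lintegral_indicator (MeasurableSet.biUnion hTc fun _ _ =>
          Metric.isClosed_closedBall.measurableSet) _
    _ ≤ ∑' x : T, ∫⁻ y in Metric.closedBall (x : EuclideanSpace ℝ (Fin n)) (5 * (2 * r x)),
          ENNReal.ofReal (h y) := by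
        rw [Set.biUnion_eq_iUnion]
        exact lintegral_iUnion_le _ _
    _ ≤ ∑' x : T, ENNReal.ofReal (V * 16 ^ n / δ) * (ENNReal.ofReal l
          * ∫⁻ y in Metric.closedBall (x : EuclideanSpace ℝ (Fin n)) (2 * r x), Y.indicator 1 y) :=
        ENNReal.tsum_le_tsum fun x => hone x x.2
    _ ≤ _ := by
        rw [ENNReal.tsum_mul_left, ENNReal.tsum_mul_left, ← lintegral_indicator_one hYm]
        gcongr
        exact tsum_setLIntegral_closedBall_le hTc hdisj _

/-- If `f` differs from `h ≥ 0` by a bounded function and `M_φ f` is integrable for some kernel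
`φ`, then `h` belongs to `L log L`. -/
theorem IsMaximalKernel.lintegral_mul_posLog_lt_top (hn : 1 ≤ n) (hφ : IsMaximalKernel φ)
    {h k : EuclideanSpace ℝ (Fin n) → ℝ} (hh : Integrable h) (h0 : ∀ y, 0 ≤ h y)
    (hk : Integrable k) {B : ℝ} (hB : 0 ≤ B) (hkB : ∀ y, |k y| ≤ B)
    (hM : ∫⁻ x, maximalFunction φ (fun y => ((h y - k y : ℝ) : 𝕜)) x < ∞) :
    ∫⁻ y, ENNReal.ofReal (h y) * ENNReal.ofReal (Real.posLog (h y)) < ∞ := by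
  obtain ⟨c, l₀, K, hc, hl₀, hK, hweak⟩ :=
    hφ.exists_setLIntegral_le_volume (𝕜 := 𝕜) hn hh h0 hk hB hkB
  set M := maximalFunction φ (fun y => ((h y - k y : ℝ) : 𝕜)) with hMdef
  have hMm : Measurable M := hφ.measurable_maximalFunction (hh.sub hk).ofReal
  have hcl : ∀ i : ℕ, ENNReal.ofReal (l₀ * 2 ^ i)
      = ENNReal.ofReal c⁻¹ * ENNReal.ofReal (c * l₀ * 2 ^ i) := fun i => by
    rw [← ENNReal.ofReal_mul (by positivity)]
    congr 1; field_simp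
  have hset : ∀ i : ℕ, MeasurableSet {x | ENNReal.ofReal (c * l₀ * 2 ^ i) < M x} := fun i =>
    measurableSet_lt measurable_const hMm
  have hhm : AEMeasurable h := hh.1.aemeasurable
  have hsum : ∫⁻ y, ENNReal.ofReal (h y) * ∑' i : ℕ, (if l₀ * 2 ^ i < h y then 1 else 0) < ∞ := by
    have hm : ∀ i : ℕ, AEMeasurable
        (fun y => ENNReal.ofReal (h y) * (if l₀ * 2 ^ i < h y then 1 else 0)) := fun i =>
      hhm.ennreal_ofReal.mul ((Measurable.ite (measurableSet_lt measurable_const measurable_id)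
        measurable_const measurable_const).comp_aemeasurable hhm)
    calc ∫⁻ y, ENNReal.ofReal (h y) * ∑' i : ℕ, (if l₀ * 2 ^ i < h y then 1 else 0)
        = ∑' i : ℕ, ∫⁻ y, ENNReal.ofReal (h y) * (if l₀ * 2 ^ i < h y then 1 else 0) := by
          rw [← lintegral_tsum hm]
          simp_rw [ENNReal.tsum_mul_left]
      _ ≤ ∑' i : ℕ, K * (ENNReal.ofReal c⁻¹ * ∫⁻ x, (if ENNReal.ofReal (c * l₀ * 2 ^ i) < M x
            then ENNReal.ofReal (c * l₀ * 2 ^ i) else 0)) := by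
          refine ENNReal.tsum_le_tsum fun i => (hweak (l₀ * 2 ^ i)
            (le_mul_of_one_le_right hl₀.le (one_le_pow₀ one_le_two))).trans (le_of_eq ?_)
          rw [hcl, mul_assoc, ← mul_assoc c]
          congr 2
          rw [← lintegral_indicator_const (hset i)]
          refine lintegral_congr fun x => ?_
          simp only [Set.indicator_apply, Set.mem_ofPred_eq]
      _ = K * (ENNReal.ofReal c⁻¹ * ∫⁻ x, ∑' i : ℕ, (if ENNReal.ofReal (c * l₀ * 2 ^ i) < M x
            then ENNReal.ofReal (c * l₀ * 2 ^ i) else 0)) := by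
          rw [ENNReal.tsum_mul_left, ENNReal.tsum_mul_left, lintegral_tsum]
          exact fun i => (Measurable.ite (hset i) measurable_const measurable_const).aemeasurable
      _ ≤ K * (ENNReal.ofReal c⁻¹ * ∫⁻ x, 2 * M x) := by
          gcongr with x
          exact ENNReal.tsum_levels_le (by positivity) (M x)
      _ < ∞ := by
          rw [lintegral_const_mul' _ _ ENNReal.ofNat_ne_top]
          finiteness [hM.ne]
  have hl2 : 0 < Real.log 2 := Real.log_pos one_lt_two
  calc ∫⁻ y, ENNReal.ofReal (h y) * ENNReal.ofReal (Real.posLog (h y))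
      ≤ ∫⁻ y, (ENNReal.ofReal (Real.posLog l₀) * ENNReal.ofReal (h y)
          + ENNReal.ofReal (Real.log 2) * (ENNReal.ofReal (h y)
            * ∑' i : ℕ, (if l₀ * 2 ^ i < h y then 1 else 0))) := by
        refine lintegral_mono fun y => ?_
        have h1 : Real.posLog (h y) ≤ Real.posLog l₀ + Real.posLog (h y / l₀) := by
          have := Real.posLog_mul (x := l₀) (y := h y / l₀)
          rwa [mul_div_cancel₀ _ hl₀.ne'] at this
        calc ENNReal.ofReal (h y) * ENNReal.ofReal (Real.posLog (h y))
            ≤ ENNReal.ofReal (h y) * (ENNReal.ofReal (Real.posLog l₀) + ENNReal.ofReal (Real.log 2)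
                * ∑' i : ℕ, (if l₀ * 2 ^ i < h y then 1 else 0)) := by
              gcongr
              refine (ENNReal.ofReal_le_ofReal h1).trans ?_
              rw [ENNReal.ofReal_add Real.posLog_nonneg Real.posLog_nonneg]
              gcongr
              exact ofReal_posLog_le_tsum one_lt_two hl₀ (h0 y)
          _ = _ := by ring
    _ = ENNReal.ofReal (Real.posLog l₀) * (∫⁻ y, ENNReal.ofReal (h y))
          + ENNReal.ofReal (Real.log 2) * ∫⁻ y, ENNReal.ofReal (h y)
            * ∑' i : ℕ, (if l₀ * 2 ^ i < h y then 1 else 0) := by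
        rw [lintegral_add_left' (hhm.ennreal_ofReal.const_mul _),
          lintegral_const_mul' _ _ ENNReal.ofReal_ne_top,
          lintegral_const_mul' _ _ ENNReal.ofReal_ne_top]
    _ < ∞ := by
        have : ∫⁻ y, ENNReal.ofReal (h y) ≠ ∞ := by
          rw [← ofReal_integral_eq_lintegral_ofReal hh (Filter.Eventually.of_forall h0)]
          exact ENNReal.ofReal_ne_top
        finiteness [hsum.ne]

end LowerBoundLevel

/-! ### Necessity of the logarithmic moment at infinity -/

section LogAtInfinity

variable {𝕜 : Type*} [RCLike 𝕜] {n : ℕ} {φ f : EuclideanSpace ℝ (Fin n) → 𝕜}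

/-- The annulus `ε * r ≤ ‖x‖ < r`. -/
def normAnnulus (n : ℕ) (ε r : ℝ) : Set (EuclideanSpace ℝ (Fin n)) :=
  {x | ε * r ≤ ‖x‖ ∧ ‖x‖ < r}

theorem measurableSet_normAnnulus (ε r : ℝ) : MeasurableSet (normAnnulus n ε r) :=
  (measurableSet_le measurable_const measurable_norm).inter
    (measurableSet_lt measurable_norm measurable_const)

theorem volume_real_normAnnulus_le (ε : ℝ) {r : ℝ} (hr : 0 < r) :
    volume.real (normAnnulus n ε r)
      ≤ r ^ n * (volume (Metric.ball (0 : EuclideanSpace ℝ (Fin n)) 1)).toReal := by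
  have h : volume.real (Metric.closedBall (0 : EuclideanSpace ℝ (Fin n)) r)
      = r ^ n * (volume (Metric.ball (0 : EuclideanSpace ℝ (Fin n)) 1)).toReal := by
    rw [measureReal_def, volume_closedBall_eq _ hr.le, ENNReal.toReal_mul,
      ENNReal.toReal_ofReal (by positivity)]
  rw [← h]
  exact measureReal_mono (fun x hx => mem_closedBall_zero_iff.2 hx.2.le)
    measure_closedBall_lt_top.ne

theorem volume_normAnnulus_lt_top (ε r : ℝ) : volume (normAnnulus n ε r) < ∞ :=
  (measure_mono fun _ hx => mem_closedBall_zero_iff.2 hx.2.le).trans_lt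
    (measure_closedBall_lt_top (x := (0 : EuclideanSpace ℝ (Fin n))) (r := r))

/-- A kernel keeps a nonzero integral when a small ball about the origin is removed. -/
theorem IsMaximalKernel.exists_integral_normAnnulus_ne_zero (hn : 1 ≤ n)
    (hφ : IsMaximalKernel φ) :
    ∃ ε : ℝ, 0 < ε ∧ ε ≤ 2⁻¹ ∧ ∫ x in normAnnulus n ε 1, φ x ≠ 0 := by
  obtain ⟨C, hC0, hC, -⟩ := hφ.exists_bound
  set V := (volume (Metric.ball (0 : EuclideanSpace ℝ (Fin n)) 1)).toReal with hV
  have hVpos : 0 < V :=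
    ENNReal.toReal_pos (Metric.measure_ball_pos _ _ one_pos).ne' measure_ball_lt_top.ne
  have ha : 0 < ‖∫ x, φ x‖ := norm_pos_iff.2 hφ.2.2
  set ε := min 2⁻¹ (‖∫ x, φ x‖ / (2 * (C * V))) with hε
  have hε0 : 0 < ε := lt_min (by norm_num) (by positivity)
  have hε1 : ε ≤ 2⁻¹ := min_le_left _ _
  refine ⟨ε, hε0, hε1, fun h0 => ?_⟩
  have hsplit : ∫ x, φ x = ∫ x in (normAnnulus n ε 1)ᶜ, φ x := by
    rw [← integral_add_compl (measurableSet_normAnnulus ε 1) hφ.integrable, h0, zero_add]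
  -- within the support of `φ`, the complement of the annulus is the ball of radius `ε`
  have hball : ∫ x in (normAnnulus n ε 1)ᶜ, φ x = ∫ x in Metric.ball 0 ε, φ x := by
    rw [← integral_indicator (measurableSet_normAnnulus ε 1).compl,
      ← integral_indicator Metric.isOpen_ball.measurableSet]
    congr 1 with x
    rcases le_or_gt 1 ‖x‖ with h1 | h1
    · rw [Set.indicator_of_notMem (s := Metric.ball 0 ε)]
      · simp [hφ.eq_zero h1]
      · rw [mem_ball_zero_iff, not_lt]
        linarith
    · have : x ∈ (normAnnulus n ε 1)ᶜ ↔ x ∈ Metric.ball 0 ε := by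
        rw [Set.mem_compl_iff, mem_ball_zero_iff, normAnnulus, Set.mem_ofPred_eq, mul_one,
          not_and', not_le]
        exact ⟨fun h => h h1, fun h _ => h⟩
      by_cases hx : x ∈ Metric.ball 0 ε
      · rw [Set.indicator_of_mem hx, Set.indicator_of_mem (this.2 hx)]
      · rw [Set.indicator_of_notMem hx, Set.indicator_of_notMem (mt this.1 hx)]
  have hle : ‖∫ x in Metric.ball 0 ε, φ x‖ ≤ C * (ε ^ n * V) := by
    have h1 := norm_setIntegral_le_of_norm_le_const (μ := volume)
      (s := Metric.ball (0 : EuclideanSpace ℝ (Fin n)) ε) (f := φ) (C := C)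
      measure_ball_lt_top (fun x _ => hC x)
    rwa [measureReal_def, Measure.addHaar_ball_of_pos _ _ hε0, finrank_euclideanSpace,
      Fintype.card_fin, ENNReal.toReal_mul, ENNReal.toReal_ofReal (by positivity)] at h1
  have h2 : ε ^ n ≤ ε := pow_le_of_le_one hε0.le (hε1.trans (by norm_num)) (by omega)
  have h3 : ε * (2 * (C * V)) ≤ ‖∫ x, φ x‖ :=
    (le_div_iff₀ (by positivity)).1 (min_le_right _ _)
  have h4 : C * (ε ^ n * V) ≤ C * (ε * V) := by gcongr
  rw [hsplit, hball] at ha h3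
  linarith

theorem integral_normAnnulus_dilate (φ : EuclideanSpace ℝ (Fin n) → 𝕜) (ε : ℝ) {r : ℝ}
    (hr : 0 < r) : ∫ x in normAnnulus n ε r, dilate φ r x = ∫ x in normAnnulus n ε 1, φ x := by
  rw [← integral_indicator (measurableSet_normAnnulus ε r),
    ← integral_indicator (measurableSet_normAnnulus ε 1), ← integral_dilate ((normAnnulus n ε 1).indicator φ) hr]
  refine integral_congr_ae (Filter.Eventually.of_forall fun x => ?_)
  have : r⁻¹ • x ∈ normAnnulus n ε 1 ↔ x ∈ normAnnulus n ε r := by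
    simp only [normAnnulus, Set.mem_ofPred_eq, norm_smul, norm_inv, Real.norm_of_nonneg hr.le,
      mul_one]
    rw [← div_eq_inv_mul, le_div_iff₀ hr, div_lt_one hr]
  by_cases h : x ∈ normAnnulus n ε r
  · rw [Set.indicator_of_mem h, dilate, dilate, Set.indicator_of_mem (this.2 h)]
  · rw [Set.indicator_of_notMem h, dilate, Set.indicator_of_notMem (mt this.1 h), smul_zero]

/-- Averaging the kernel of scale `r` over an annulus of radius `r` gives, as a function of the
centre `y`, a smoothed version of a constant times the indicator of the ball of radius `r`. -/
theorem IsMaximalKernel.enorm_integral_normAnnulus_sub_le (hφ : IsMaximalKernel φ) {C : ℝ}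
    (hC0 : 0 < C) (hC : ∀ x, ‖φ x‖ ≤ C) (hC' : ∀ x y, ‖φ x - φ y‖ ≤ C * ‖x - y‖) (ε : ℝ) {r : ℝ}
    (hr : 0 < r) (y : EuclideanSpace ℝ (Fin n)) :
    ‖(∫ x in normAnnulus n ε r, dilate φ r (x - y))
        - (Metric.closedBall 0 r).indicator (fun _ => ∫ x in normAnnulus n ε 1, φ x) y‖ₑ
      ≤ ENNReal.ofReal (C * (volume (Metric.ball (0 : EuclideanSpace ℝ (Fin n)) 1)).toReal)
        * ((if ‖y‖ ≤ r then ENNReal.ofReal (‖y‖ / r) else 0)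
          + (if r ≤ ‖y‖ ∧ ‖y‖ < 2 * r then 1 else 0)) := by
  set V := (volume (Metric.ball (0 : EuclideanSpace ℝ (Fin n)) 1)).toReal with hV
  have hV0 : 0 ≤ V := ENNReal.toReal_nonneg
  have hvol := volume_real_normAnnulus_le (n := n) ε hr
  have hfin := volume_normAnnulus_lt_top (n := n) ε r
  have hint : ∀ z, IntegrableOn (fun x => dilate φ r (x - z)) (normAnnulus n ε r) := fun z =>
    ((hφ.integrable_dilate hr).comp_sub_right z).integrableOn
  rcases le_or_gt ‖y‖ r with h | h
  · rw [Set.indicator_of_mem (mem_closedBall_zero_iff.2 h), if_pos h,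
      ← integral_normAnnulus_dilate φ ε hr, ← integral_sub (hint y)
      (hφ.integrable_dilate hr).integrableOn, mul_add]
    refine le_add_right ?_
    rw [← ENNReal.ofReal_mul (by positivity), ← ofReal_norm]
    refine ENNReal.ofReal_le_ofReal ((norm_setIntegral_le_of_norm_le_const hfin
      (C := C * (r ^ n)⁻¹ * (‖y‖ / r)) fun x _ => ?_).trans ?_)
    · have := norm_dilate_sub_le hC' hr (x - y) x
      rwa [show x - y - x = -y by abel, norm_neg] at this
    · calc C * (r ^ n)⁻¹ * (‖y‖ / r) * volume.real (normAnnulus n ε r)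
          ≤ C * (r ^ n)⁻¹ * (‖y‖ / r) * (r ^ n * V) := by gcongr
        _ = C * V * (‖y‖ / r) := by field_simp
  · rw [Set.indicator_of_notMem (by simpa using h), sub_zero, if_neg (not_le.2 h), zero_add]
    rcases lt_or_ge ‖y‖ (2 * r) with h2 | h2
    · rw [if_pos ⟨h.le, h2⟩, mul_one, ← ofReal_norm]
      refine ENNReal.ofReal_le_ofReal ((norm_setIntegral_le_of_norm_le_const hfin
        (C := C * (r ^ n)⁻¹) fun x _ => norm_dilate_le hC hr _).trans ?_)
      calc C * (r ^ n)⁻¹ * volume.real (normAnnulus n ε r) ≤ C * (r ^ n)⁻¹ * (r ^ n * V) := by gcongr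
        _ = C * V := by field_simp
    · have : ∫ x in normAnnulus n ε r, dilate φ r (x - y) = 0 := by
        refine setIntegral_eq_zero_of_forall_eq_zero fun x hx => hφ.dilate_eq_zero hr ?_
        have h3 := norm_sub_norm_le y x
        rw [norm_sub_rev] at h3
        linarith [hx.2]
      rw [this, enorm_zero]
      exact zero_le

/-- The mass of `f` outside the ball of radius `r` is bounded by the integral of `M_φ f` over an
annulus of radius `r` and an error whose sum over a geometric progression of radii is finite. -/
theorem IsMaximalKernel.enorm_mul_lintegral_compl_closedBall_le (hφ : IsMaximalKernel φ) {C : ℝ}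
    (hC0 : 0 < C) (hC : ∀ x, ‖φ x‖ ≤ C) (hC' : ∀ x y, ‖φ x - φ y‖ ≤ C * ‖x - y‖)
    (hf : Integrable f) (hf0 : ∫ y, f y = 0) {h : EuclideanSpace ℝ (Fin n) → ℝ} (h0 : ∀ y, 0 ≤ h y)
    {r : ℝ} (hr : 0 < r) (hfh : ∀ y, r < ‖y‖ → f y = (h y : 𝕜)) (ε : ℝ) :
    ‖∫ x in normAnnulus n ε 1, φ x‖ₑ * ∫⁻ y in (Metric.closedBall 0 r)ᶜ, ‖f y‖ₑ
      ≤ ENNReal.ofReal (C * (volume (Metric.ball (0 : EuclideanSpace ℝ (Fin n)) 1)).toReal)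
          * (∫⁻ y, ((if ‖y‖ ≤ r then ENNReal.ofReal (‖y‖ / r) else 0)
            + (if r ≤ ‖y‖ ∧ ‖y‖ < 2 * r then 1 else 0)) * ‖f y‖ₑ)
        + ∫⁻ x in normAnnulus n ε r, maximalFunction φ f x := by
  have hBm : MeasurableSet (Metric.closedBall (0 : EuclideanSpace ℝ (Fin n)) r) :=
    Metric.isClosed_closedBall.measurableSet
  have hZm := measurableSet_normAnnulus (n := n) ε r
  set c := ∫ x in normAnnulus n ε 1, φ x with hc
  set E : EuclideanSpace ℝ (Fin n) → 𝕜 := fun y => (∫ x in normAnnulus n ε r, dilate φ r (x - y))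
    - (Metric.closedBall 0 r).indicator (fun _ => c) y with hE
  -- positivity of `f` far out turns the integral of `|f|` into the absolute value of an integral
  have hpos : ∫⁻ y in (Metric.closedBall 0 r)ᶜ, ‖f y‖ₑ
      = ‖∫ y in (Metric.closedBall 0 r)ᶜ, f y‖ₑ := by
    have h1 : ∀ y ∈ (Metric.closedBall (0 : EuclideanSpace ℝ (Fin n)) r)ᶜ,
        f y = ((‖f y‖ : ℝ) : 𝕜) := fun y hy => by
      rw [hfh y (by simpa using hy), RCLike.norm_ofReal, abs_of_nonneg (h0 y)]
    rw [setIntegral_congr_fun hBm.compl h1, integral_ofReal, ← ofReal_norm, RCLike.norm_ofReal,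
      abs_of_nonneg (integral_nonneg fun _ => norm_nonneg _),
      ofReal_integral_norm_eq_lintegral_enorm hf.integrableOn]
  have hcompl : ∫ y in (Metric.closedBall 0 r)ᶜ, f y = -∫ y in Metric.closedBall 0 r, f y := by
    have := integral_add_compl hBm hf
    rw [hf0] at this
    exact eq_neg_of_add_eq_zero_right this
  have hind : ∀ g : EuclideanSpace ℝ (Fin n) → 𝕜,
      ∫ x, (normAnnulus n ε r).indicator (fun _ => 1) x * g x = ∫ x in normAnnulus n ε r, g x := by
    intro g
    rw [← integral_indicator hZm]
    congr 1 with x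
    by_cases hx : x ∈ normAnnulus n ε r <;> simp [hx]
  have hη : AEStronglyMeasurable ((normAnnulus n ε r).indicator fun _ => (1 : 𝕜)) :=
    aestronglyMeasurable_const.indicator hZm
  have hη1 : ∀ x, ‖(normAnnulus n ε r).indicator (fun _ => (1 : 𝕜)) x‖ ≤ 1 := fun x => by
    by_cases hx : x ∈ normAnnulus n ε r <;> simp [hx]
  have hfub : ∫ x in normAnnulus n ε r, ∫ y, dilate φ r (x - y) * f y
      = ∫ y, (∫ x in normAnnulus n ε r, dilate φ r (x - y)) * f y := by
    have h1 := hφ.integral_mul_convolution_eq hf hr hη hη1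
    simp_rw [hind] at h1
    exact h1
  have hGi : Integrable fun y => (∫ x in normAnnulus n ε r, dilate φ r (x - y)) * f y := by
    have h1 := hφ.integrable_integral_mul_dilate_mul hf hr hη hη1
    simp_rw [hind] at h1
    exact h1
  have hmain : c * ∫ y in (Metric.closedBall 0 r)ᶜ, f y
      = (∫ y, E y * f y) - ∫ x in normAnnulus n ε r, ∫ y, dilate φ r (x - y) * f y := by
    have h1 : ∀ y, E y * f y = (∫ x in normAnnulus n ε r, dilate φ r (x - y)) * f y
        - c * (Metric.closedBall 0 r).indicator f y := by
      intro y
      rw [hE, sub_mul]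
      congr 1
      by_cases hy : y ∈ Metric.closedBall 0 r
      · rw [Set.indicator_of_mem hy, Set.indicator_of_mem hy]
      · rw [Set.indicator_of_notMem hy, Set.indicator_of_notMem hy, zero_mul, mul_zero]
    simp_rw [h1]
    rw [integral_sub hGi ((hf.indicator hBm).const_mul c), integral_const_mul,
      integral_indicator hBm, hfub, hcompl]
    ring
  rw [hpos, ← enorm_mul, hmain]
  refine enorm_sub_le.trans (add_le_add ?_ ?_)
  · refine (enorm_integral_le_lintegral_enorm _).trans ?_
    rw [← lintegral_const_mul' _ _ ENNReal.ofReal_ne_top]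
    refine lintegral_mono fun y => ?_
    rw [enorm_mul, ← mul_assoc]
    exact mul_le_mul_left (hφ.enorm_integral_normAnnulus_sub_le hC0 hC hC' ε hr y) _
  · exact (enorm_integral_le_lintegral_enorm _).trans (lintegral_mono fun x =>
      enorm_convolution_dilate_le_maximalFunction φ f hr x)

/-- If `f` has mean value zero, is nonnegative off a ball, and `M_φ f` is integrable for some kernel
`φ`, then `|f| ln₊ |x|` is integrable. -/
theorem IsMaximalKernel.lintegral_mul_posLog_norm_lt_top (hn : 1 ≤ n) (hφ : IsMaximalKernel φ)
    (hf : Integrable f) (hf0 : ∫ y, f y = 0) {h : EuclideanSpace ℝ (Fin n) → ℝ} (h0 : ∀ y, 0 ≤ h y)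
    {R : ℝ} (hR : 0 < R) (hfh : ∀ y, R < ‖y‖ → f y = (h y : 𝕜))
    (hM : ∫⁻ x, maximalFunction φ f x < ∞) :
    ∫⁻ y, ‖f y‖ₑ * ENNReal.ofReal (Real.posLog ‖y‖) < ∞ := by
  obtain ⟨C, hC0, hC, hC'⟩ := hφ.exists_bound
  obtain ⟨ε, hε0, hε2, hc⟩ := hφ.exists_integral_normAnnulus_ne_zero hn
  set c := ∫ x in normAnnulus n ε 1, φ x with hcdef
  have hc0 : ‖c‖ₑ ≠ 0 := enorm_ne_zero.2 hc
  set D := ENNReal.ofReal (C * (volume (Metric.ball (0 : EuclideanSpace ℝ (Fin n)) 1)).toReal)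
    with hD
  -- the radii form a progression of ratio `1 / ε`, which makes the annuli disjoint
  set a := ε⁻¹ with ha
  have ha2 : 2 ≤ a := (le_inv_comm₀ two_pos hε0).2 hε2
  have ha1 : 1 < a := by linarith
  have ha0 : 0 < a := by linarith
  have hRa : ∀ k : ℕ, 0 < R * a ^ k := fun k => by positivity
  have hRle : ∀ k : ℕ, R ≤ R * a ^ k := fun k => le_mul_of_one_le_right hR.le (one_le_pow₀ ha1.le)
  have hfe : AEMeasurable fun y => ‖f y‖ₑ := hf.1.enorm
  have hMm := hφ.measurable_maximalFunction hf
  set w : ℕ → EuclideanSpace ℝ (Fin n) → ℝ≥0∞ := fun k y =>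
    (if ‖y‖ ≤ R * a ^ k then ENNReal.ofReal (‖y‖ / (R * a ^ k)) else 0)
      + (if R * a ^ k ≤ ‖y‖ ∧ ‖y‖ < 2 * (R * a ^ k) then 1 else 0) with hw
  have hwm : ∀ k, Measurable (w k) := fun k =>
    (Measurable.ite (measurableSet_le measurable_norm measurable_const)
      (measurable_norm.div_const _).ennreal_ofReal measurable_const).add
    (Measurable.ite ((measurableSet_le measurable_const measurable_norm).inter
      (measurableSet_lt measurable_norm measurable_const)) measurable_const measurable_const)
  set W := (1 - ENNReal.ofReal a⁻¹)⁻¹ + 1 with hW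
  have hWtop : W ≠ ∞ := by
    have : (1 : ℝ≥0∞) - ENNReal.ofReal a⁻¹ ≠ 0 :=
      (tsub_pos_of_lt (ENNReal.ofReal_lt_one.2 (inv_lt_one_of_one_lt₀ ha1))).ne'
    finiteness
  have hwsum : ∀ y, ∑' k, w k y ≤ W := by
    intro y
    rw [hw, ENNReal.tsum_add]
    refine add_le_add (tsum_ite_div_mul_pow_le ha1 hR) ?_
    have := tsum_ite_window_le (a := a) (p := R) (q := 2 * R) (z := ‖y‖) (m := 1) ha1 hR
      (by rw [pow_one, mul_comm]; gcongr)
    simpa only [mul_assoc, Nat.cast_one] using this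
  have herr : ∑' k, ∫⁻ y, w k y * ‖f y‖ₑ < ∞ := by
    have hm : ∀ k, AEMeasurable fun y => w k y * ‖f y‖ₑ := fun k => (hwm k).aemeasurable.mul hfe
    rw [← lintegral_tsum hm]
    simp_rw [ENNReal.tsum_mul_right]
    refine (lintegral_mono fun y => mul_le_mul_left (hwsum y) _).trans_lt ?_
    rw [lintegral_const_mul' _ _ hWtop]
    exact ENNReal.mul_lt_top hWtop.lt_top hf.2
  have hmax : ∑' k : ℕ, ∫⁻ x in normAnnulus n ε (R * a ^ k), maximalFunction φ f x < ∞ := by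
    simp_rw [← lintegral_indicator (measurableSet_normAnnulus _ _)]
    have hm : ∀ k : ℕ, AEMeasurable ((normAnnulus n ε (R * a ^ k)).indicator
        (maximalFunction φ f)) := fun k =>
      (hMm.indicator (measurableSet_normAnnulus _ _)).aemeasurable
    rw [← lintegral_tsum hm]
    refine (lintegral_mono fun x => ?_).trans_lt hM
    have h1 := tsum_ite_window_le (a := a) (p := ε * R) (q := R) (z := ‖x‖) (m := 1) ha1
      (by positivity) (by rw [pow_one, ha]; field_simp; rfl)
    calc ∑' k : ℕ, (normAnnulus n ε (R * a ^ k)).indicator (maximalFunction φ f) x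
        = ∑' k : ℕ, (if ε * R * a ^ k ≤ ‖x‖ ∧ ‖x‖ < R * a ^ k then (1 : ℝ≥0∞) else 0)
            * maximalFunction φ f x := by
          refine tsum_congr fun k => ?_
          simp only [Set.indicator_apply, normAnnulus, Set.mem_ofPred_eq, ite_mul, one_mul,
            zero_mul, mul_assoc]
      _ ≤ 1 * maximalFunction φ f x := by
          rw [ENNReal.tsum_mul_right]
          gcongr
          simpa using h1
      _ = _ := one_mul _
  have htail : ∑' k : ℕ, ∫⁻ y in (Metric.closedBall 0 (R * a ^ k))ᶜ, ‖f y‖ₑ < ∞ := by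
    have h1 : ‖c‖ₑ * ∑' k : ℕ, ∫⁻ y in (Metric.closedBall 0 (R * a ^ k))ᶜ, ‖f y‖ₑ < ∞ := by
      rw [← ENNReal.tsum_mul_left]
      refine (ENNReal.tsum_le_tsum fun k => hφ.enorm_mul_lintegral_compl_closedBall_le hC0 hC hC'
        hf hf0 h0 (hRa k) (fun y hy => hfh y ((hRle k).trans_lt hy)) ε).trans_lt ?_
      rw [ENNReal.tsum_add, ENNReal.tsum_mul_left]
      exact ENNReal.add_lt_top.2 ⟨ENNReal.mul_lt_top ENNReal.ofReal_lt_top herr, hmax⟩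
    exact ENNReal.lt_top_of_mul_ne_top_right h1.ne hc0
  have hcount : ∫⁻ y, ‖f y‖ₑ * ∑' k : ℕ, (if R * a ^ k < ‖y‖ then 1 else 0) < ∞ := by
    have hm : ∀ k : ℕ, AEMeasurable fun y => ‖f y‖ₑ * (if R * a ^ k < ‖y‖ then 1 else 0) :=
      fun k => hfe.mul (Measurable.ite (measurableSet_lt measurable_const measurable_norm)
        measurable_const measurable_const).aemeasurable
    simp_rw [← ENNReal.tsum_mul_left]
    rw [lintegral_tsum hm]
    refine lt_of_eq_of_lt (tsum_congr fun k => ?_) htail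
    rw [← lintegral_indicator Metric.isClosed_closedBall.measurableSet.compl]
    refine lintegral_congr fun y => ?_
    by_cases hy : R * a ^ k < ‖y‖
    · rw [if_pos hy, mul_one, Set.indicator_of_mem (by simpa using hy)]
    · rw [if_neg hy, mul_zero, Set.indicator_of_notMem (by simpa using hy)]
  refine (lintegral_mono (g := fun y => ENNReal.ofReal (Real.posLog R) * ‖f y‖ₑ
    + ENNReal.ofReal (Real.log a)
      * (‖f y‖ₑ * ∑' k : ℕ, (if R * a ^ k < ‖y‖ then 1 else 0))) fun y => ?_).trans_lt ?_
  · have h1 : Real.posLog ‖y‖ ≤ Real.posLog R + Real.posLog (‖y‖ / R) := by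
      have := Real.posLog_mul (x := R) (y := ‖y‖ / R)
      rwa [mul_div_cancel₀ _ hR.ne'] at this
    calc ‖f y‖ₑ * ENNReal.ofReal (Real.posLog ‖y‖)
        ≤ ‖f y‖ₑ * (ENNReal.ofReal (Real.posLog R) + ENNReal.ofReal (Real.log a)
            * ∑' k : ℕ, (if R * a ^ k < ‖y‖ then 1 else 0)) := by
          gcongr
          refine (ENNReal.ofReal_le_ofReal h1).trans ?_
          rw [ENNReal.ofReal_add Real.posLog_nonneg Real.posLog_nonneg]
          gcongr
          exact ofReal_posLog_le_tsum ha1 hR (norm_nonneg y)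
      _ = _ := by ring
  · rw [lintegral_add_left' (hfe.const_mul _), lintegral_const_mul' _ _ ENNReal.ofReal_ne_top,
      lintegral_const_mul' _ _ ENNReal.ofReal_ne_top]
    exact ENNReal.add_lt_top.2 ⟨ENNReal.mul_lt_top ENNReal.ofReal_lt_top hf.2,
      ENNReal.mul_lt_top ENNReal.ofReal_lt_top hcount⟩

end LogAtInfinity

/-! ### The logarithmic moment condition -/

section LogMoment

variable {𝕜 : Type*} [RCLike 𝕜] {n : ℕ}

/-- The integrand `s (ln₊ s + ln₊ r)` of the logarithmic moment, at a function value of modulus `s`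
and a point of norm `r`. -/
def logMoment (s r : ℝ) : ℝ≥0∞ :=
  ENNReal.ofReal s * ENNReal.ofReal (Real.posLog s + Real.posLog r)

theorem logMoment_mono {s s' : ℝ} (r : ℝ) (hs : 0 ≤ s) (h : s ≤ s') :
    logMoment s r ≤ logMoment s' r := by
  unfold logMoment
  gcongr

theorem logMoment_mul_le {a s : ℝ} (r : ℝ) (ha : 0 ≤ a) :
    logMoment (a * s) r ≤ ENNReal.ofReal a * (ENNReal.ofReal (Real.posLog a) * ENNReal.ofReal s
      + logMoment s r) := by
  unfold logMoment
  have h1 : ENNReal.ofReal (Real.posLog (a * s) + Real.posLog r)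
      ≤ ENNReal.ofReal (Real.posLog a) + ENNReal.ofReal (Real.posLog s + Real.posLog r) := by
    rw [← ENNReal.ofReal_add Real.posLog_nonneg (add_nonneg Real.posLog_nonneg Real.posLog_nonneg),
      ← add_assoc]
    exact ENNReal.ofReal_le_ofReal (add_le_add_left Real.posLog_mul _)
  rw [ENNReal.ofReal_mul ha]
  calc _ ≤ ENNReal.ofReal a * ENNReal.ofReal s * (ENNReal.ofReal (Real.posLog a)
        + ENNReal.ofReal (Real.posLog s + Real.posLog r)) := by gcongr
    _ = _ := by ring

theorem mem_logIntegrable_iff (f : Lp 𝕜 1 (volume : Measure (EuclideanSpace ℝ (Fin n)))) :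
    f ∈ logIntegrable 𝕜 n ↔ ∫⁻ x, logMoment ‖f x‖ ‖x‖ < ∞ := by
  unfold logMoment
  simp_rw [ofReal_norm]
  rfl

theorem lintegral_logMoment_mul_lt_top {f : EuclideanSpace ℝ (Fin n) → 𝕜} (hf : Integrable f)
    (hlog : ∫⁻ x, logMoment ‖f x‖ ‖x‖ < ∞) {a : ℝ} (ha : 0 ≤ a) :
    ∫⁻ x, logMoment (a * ‖f x‖) ‖x‖ < ∞ := by
  refine (lintegral_mono fun x => logMoment_mul_le ‖x‖ ha).trans_lt ?_
  rw [lintegral_const_mul' _ _ ENNReal.ofReal_ne_top,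
    lintegral_add_left' (hf.1.norm.aemeasurable.ennreal_ofReal.const_mul _),
    lintegral_const_mul' _ _ ENNReal.ofReal_ne_top]
  simp_rw [ofReal_norm]
  exact ENNReal.mul_lt_top ENNReal.ofReal_lt_top (ENNReal.add_lt_top.2
    ⟨ENNReal.mul_lt_top ENNReal.ofReal_lt_top hf.2, hlog⟩)

/-- The functions with a logarithmic moment form a vector space. -/
def logIntegrableSubmodule (𝕜 : Type*) [RCLike 𝕜] (n : ℕ) :
    Submodule 𝕜 (Lp 𝕜 1 (volume : Measure (EuclideanSpace ℝ (Fin n)))) where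
  carrier := logIntegrable 𝕜 n
  zero_mem' := by
    rw [mem_logIntegrable_iff, lintegral_congr_ae (g := fun _ => 0)]
    · simp
    · filter_upwards [Lp.coeFn_zero 𝕜 1 (volume : Measure (EuclideanSpace ℝ (Fin n)))] with x hx
      rw [hx]
      simp [logMoment]
  add_mem' := by
    intro f g hf hg
    rw [mem_logIntegrable_iff] at hf hg ⊢
    have hfi := memLp_one_iff_integrable.1 (Lp.memLp f)
    have hgi := memLp_one_iff_integrable.1 (Lp.memLp g)
    have hf2 := lintegral_logMoment_mul_lt_top hfi hf zero_le_two
    have hg2 := lintegral_logMoment_mul_lt_top hgi hg zero_le_two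
    have hm : AEMeasurable fun x => logMoment (2 * ‖f x‖) ‖x‖ := by
      have h1 : Measurable fun p : ℝ × ℝ => logMoment p.1 p.2 :=
        measurable_fst.ennreal_ofReal.mul
          (((Real.continuous_posLog.measurable.comp measurable_fst).add
            (Real.continuous_posLog.measurable.comp measurable_snd)).ennreal_ofReal)
      exact h1.comp_aemeasurable ((hfi.1.norm.aemeasurable.const_mul 2).prodMk
        measurable_norm.aemeasurable)
    refine (lintegral_mono_ae (g := fun x => logMoment (2 * ‖f x‖) ‖x‖
      + logMoment (2 * ‖g x‖) ‖x‖) ?_).trans_lt ?_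
    · filter_upwards [Lp.coeFn_add f g] with x hx
      rw [hx, Pi.add_apply]
      have h1 := norm_add_le (f x) (g x)
      rcases le_total ‖f x‖ ‖g x‖ with h | h
      · exact (logMoment_mono _ (norm_nonneg _) (by linarith)).trans le_add_self
      · exact (logMoment_mono _ (norm_nonneg _) (by linarith)).trans le_self_add
    · rw [lintegral_add_left' hm]
      exact ENNReal.add_lt_top.2 ⟨hf2, hg2⟩
  smul_mem' := by
    intro c f hf
    rw [mem_logIntegrable_iff] at hf ⊢
    refine lt_of_eq_of_lt (lintegral_congr_ae ?_) (lintegral_logMoment_mul_lt_top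
      (memLp_one_iff_integrable.1 (Lp.memLp f)) hf (norm_nonneg c))
    filter_upwards [Lp.coeFn_smul c f] with x hx
    rw [hx, Pi.smul_apply, norm_smul]

theorem dominationProperty_logIntegrableSubmodule (hn : 1 ≤ n) :
    DominationProperty (logIntegrableSubmodule 𝕜 n) := by
  intro g hg f hfg hf0
  obtain ⟨φ, hφ⟩ := exists_isMaximalKernel 𝕜 n
  have hg' : ∫⁻ x, logMoment ‖g x‖ ‖x‖ < ∞ := (mem_logIntegrable_iff g).1 hg
  have hf : f ∈ logIntegrable 𝕜 n := by
    rw [mem_logIntegrable_iff]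
    refine (lintegral_mono_ae ?_).trans_lt hg'
    filter_upwards [hfg] with x hx
    exact logMoment_mono _ (norm_nonneg _) hx
  exact ⟨φ, hφ, hφ.lintegral_maximalFunction_lt_top hn (memLp_one_iff_integrable.1 (Lp.memLp f))
    hf0 hf⟩

/-- A nonzero function has some mass on a bounded set on which it is bounded. -/
theorem exists_setIntegral_norm_pos {g : EuclideanSpace ℝ (Fin n) → 𝕜} (hg : Integrable g)
    (hgm : StronglyMeasurable g) (hpos : 0 < ∫ x, ‖g x‖) :
    ∃ m : ℕ, MeasurableSet {x | ‖x‖ ≤ m ∧ ‖g x‖ ≤ m} ∧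
      0 < ∫ x in {x | ‖x‖ ≤ m ∧ ‖g x‖ ≤ m}, ‖g x‖ := by
  have hmeas : ∀ m : ℕ, MeasurableSet {x | ‖x‖ ≤ m ∧ ‖g x‖ ≤ m} := fun m =>
    (measurableSet_le measurable_norm measurable_const).inter
      (measurableSet_le hgm.norm.measurable measurable_const)
  by_contra! hcon
  have hzero : ∀ m : ℕ, ∀ᵐ x, x ∈ {x | ‖x‖ ≤ m ∧ ‖g x‖ ≤ m} → g x = 0 := by
    intro m
    have h1 : ∫ x in {x | ‖x‖ ≤ m ∧ ‖g x‖ ≤ m}, ‖g x‖ = 0 :=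
      le_antisymm (hcon m (hmeas m)) (integral_nonneg fun _ => norm_nonneg _)
    have h2 := (integral_eq_zero_iff_of_nonneg (fun _ => norm_nonneg _) hg.norm.integrableOn).1 h1
    filter_upwards [(ae_restrict_iff' (hmeas m)).1 h2] with x hx hxm
    exact norm_eq_zero.1 (hx hxm)
  have hall : ∀ᵐ x, ‖g x‖ = 0 := by
    filter_upwards [ae_all_iff.2 hzero] with x hx
    obtain ⟨m, hm⟩ := exists_nat_ge (max ‖x‖ ‖g x‖)
    rw [hx m ⟨(le_max_left _ _).trans hm, (le_max_right _ _).trans hm⟩, norm_zero]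
  rw [integral_congr_ae hall] at hpos
  simp at hpos

/-- Every element of a space with the domination property has a logarithmic moment. The test
function is `|g| - T |g| 1_F`, where `F` is a bounded set on which `g` is bounded and `1 / T` is the
share of the mass of `g` carried by `F`: it has mean value zero, is dominated by `T |g|`, and
differs from `|g|` by a bounded function of bounded support. -/
theorem DominationProperty.subset_logIntegrable (hn : 1 ≤ n)
    {S : Submodule 𝕜 (Lp 𝕜 1 (volume : Measure (EuclideanSpace ℝ (Fin n))))}
    (hS : DominationProperty S) {g : Lp 𝕜 1 (volume : Measure (EuclideanSpace ℝ (Fin n)))}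
    (hgS : g ∈ S) : g ∈ logIntegrable 𝕜 n := by
  rw [mem_logIntegrable_iff]
  have hg := memLp_one_iff_integrable.1 (Lp.memLp g)
  have hw0 : ∀ x, 0 ≤ ‖g x‖ := fun x => norm_nonneg _
  rcases (integral_nonneg hw0 : 0 ≤ ∫ x, ‖g x‖).eq_or_lt with hzero | hpos
  · have h1 := (integral_eq_zero_iff_of_nonneg hw0 hg.norm).1 hzero.symm
    rw [lintegral_congr_ae (g := fun _ => 0)]
    · simp
    · filter_upwards [h1] with x hx
      rw [hx]
      simp [logMoment]
  obtain ⟨m, hFm, hβ⟩ := exists_setIntegral_norm_pos hg (Lp.stronglyMeasurable g) hpos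
  set F := {x : EuclideanSpace ℝ (Fin n) | ‖x‖ ≤ m ∧ ‖g x‖ ≤ m} with hF
  set T := (∫ x, ‖g x‖) / ∫ x in F, ‖g x‖ with hT
  have hT1 : 1 ≤ T := (one_le_div hβ).2 (setIntegral_le_integral hg.norm
    (Filter.Eventually.of_forall hw0))
  have hT0 : 0 ≤ T := zero_le_one.trans hT1
  set k : EuclideanSpace ℝ (Fin n) → ℝ := fun x => T * F.indicator (fun x => ‖g x‖) x with hk
  have hki : Integrable k := (hg.norm.indicator hFm).const_mul T
  have hkB : ∀ x, |k x| ≤ T * m := by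
    intro x
    rw [hk, abs_mul, abs_of_nonneg hT0]
    refine mul_le_mul_of_nonneg_left ?_ hT0
    by_cases hx : x ∈ F
    · rw [Set.indicator_of_mem hx, abs_norm]
      exact hx.2
    · rw [Set.indicator_of_notMem hx, abs_zero]
      positivity
  set f : EuclideanSpace ℝ (Fin n) → 𝕜 := fun x => ((‖g x‖ - k x : ℝ) : 𝕜) with hf
  have hfi : Integrable f := (hg.norm.sub hki).ofReal
  have hf0 : ∫ x, f x = 0 := by
    rw [hf, integral_ofReal, integral_sub hg.norm hki, hk, integral_const_mul,
      integral_indicator hFm, hT, div_mul_cancel₀ _ hβ.ne', sub_self, RCLike.ofReal_zero]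
  have hfle : ∀ x, ‖f x‖ ≤ T * ‖g x‖ := by
    intro x
    have h1 : ‖g x‖ ≤ T * ‖g x‖ := le_mul_of_one_le_left (hw0 x) hT1
    rw [hf, RCLike.norm_ofReal, abs_le]
    by_cases hx : x ∈ F
    · simp only [hk, Set.indicator_of_mem hx]
      constructor <;> linarith [hw0 x]
    · simp only [hk, Set.indicator_of_notMem hx, mul_zero, sub_zero]
      constructor <;> linarith [hw0 x]
  -- the domination property, applied to the multiple `T • g` of `g`
  have hfL : MemLp f 1 volume := memLp_one_iff_integrable.2 hfi
  have hmem : hfL.toLp f ∈ hardySpace 𝕜 n := by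
    refine hS ((T : 𝕜) • g) (S.smul_mem _ hgS) _ ?_ ?_
    · filter_upwards [hfL.coeFn_toLp, Lp.coeFn_smul (T : 𝕜) g] with x hx hx'
      have hTn : ‖(T : 𝕜)‖ = T := by rw [RCLike.norm_ofReal, abs_of_nonneg hT0]
      rw [hx, hx', Pi.smul_apply, norm_smul, hTn]
      exact hfle x
    · rw [integral_congr_ae hfL.coeFn_toLp, hf0]
  obtain ⟨φ, hφ, hM⟩ := hmem
  rw [maximalFunction_congr_ae hfL.coeFn_toLp] at hM
  have hlog1 := hφ.lintegral_mul_posLog_lt_top hn hg.norm hw0 hki (by positivity) hkB hM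
  have hfar : ∀ x : EuclideanSpace ℝ (Fin n), (m : ℝ) + 1 < ‖x‖ → f x = ((‖g x‖ : ℝ) : 𝕜) := by
    intro x hx
    have : x ∉ F := fun hxF => by linarith [hxF.1]
    simp only [hf, hk, Set.indicator_of_notMem this, mul_zero, sub_zero]
  have hlog2 := hφ.lintegral_mul_posLog_norm_lt_top hn hfi hf0 hw0
    (by positivity : (0 : ℝ) < m + 1) hfar hM
  have hlm : AEMeasurable fun x => ENNReal.ofReal ‖g x‖ * ENNReal.ofReal (Real.posLog ‖g x‖) :=
    hg.1.norm.aemeasurable.ennreal_ofReal.mul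
      (Real.continuous_posLog.measurable.comp_aemeasurable hg.1.norm.aemeasurable).ennreal_ofReal
  have hlm2 : AEMeasurable fun x => ‖f x‖ₑ * ENNReal.ofReal (Real.posLog ‖x‖) :=
    hfi.1.enorm.mul (Real.continuous_posLog.measurable.comp
      measurable_norm).ennreal_ofReal.aemeasurable
  refine (lintegral_mono (g := fun x => ENNReal.ofReal ‖g x‖ * ENNReal.ofReal (Real.posLog ‖g x‖)
    + (‖f x‖ₑ * ENNReal.ofReal (Real.posLog ‖x‖)
      + ENNReal.ofReal (Real.posLog (m + 1)) * ‖g x‖ₑ)) fun x => ?_).trans_lt ?_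
  · rw [logMoment, ENNReal.ofReal_add Real.posLog_nonneg Real.posLog_nonneg, mul_add]
    refine add_le_add le_rfl ?_
    rcases lt_or_ge ((m : ℝ) + 1) ‖x‖ with hx | hx
    · refine le_add_right ?_
      rw [hfar x hx, ← ofReal_norm, RCLike.norm_ofReal, abs_norm]
    · refine le_add_left ?_
      rw [mul_comm, ofReal_norm]
      gcongr
  · rw [lintegral_add_left' hlm, lintegral_add_left' hlm2,
      lintegral_const_mul' _ _ ENNReal.ofReal_ne_top]
    exact ENNReal.add_lt_top.2 ⟨hlog1, ENNReal.add_lt_top.2 ⟨hlog2,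
      ENNReal.mul_lt_top ENNReal.ofReal_lt_top hg.2⟩⟩

end LogMoment

end

theorem mainTheorem2 {𝕜 : Type*} [RCLike 𝕜] (n : ℕ) (hn : 1 ≤ n) :
    ∃ L : Submodule 𝕜 (Lp 𝕜 1 (volume : Measure (EuclideanSpace ℝ (Fin n)))),
      (L : Set (Lp 𝕜 1 (volume : Measure (EuclideanSpace ℝ (Fin n))))) = logIntegrable 𝕜 n ∧
        IsGreatest {S : Submodule 𝕜 (Lp 𝕜 1 (volume : Measure (EuclideanSpace ℝ (Fin n)))) |
          DominationProperty S} L :=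
  ⟨logIntegrableSubmodule 𝕜 n, rfl, dominationProperty_logIntegrableSubmodule hn,
    fun _ hS _ hg => hS.subset_logIntegrable hn hg⟩
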